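/- Let $\mathbb{F}_q$ be the finite field with $q$ elements, let $V=\mathbb{F}_q^n$ with standard basis $e_1,\dots,e_n$, and let $1<k<n-1$. A linear $[n,k]_q$ code is a $k$-dimensional subspace of $V$; it is non-degenerate if the restriction of every coordinate functional $x\mapsto x_i$ to it is non-zero. Let $\Gamma(n,k)_q$ be the graph whose vertices are the non-degenerate linear $[n,k]_q$ codes, two of them being adjacent if their intersection is $(k-1)$-dimensional. A semilinear automorphism of $V$ is an additive bijection $l:V\to V$ for which there is a field automorphism $\sigma$ of $\mathbb{F}_q$ with $l(ax)=\sigma(a)l(x)$ for all $a\in\mathbb{F}_q$ and $x\in V$; it is monomial if there are a permutation $\delta$ of $\{1,\dots,n\}$ and non-zero scalars $a_1,\dots,a_n\in\mathbb{F}_q$ such that $l(e_i)=a_i e_{\delta(i)}$ for all $i$. Then every automorphism $f$ of the graph $\Gamma(n,k)_q$ is induced by a monomial semilinear automorphism $l$ of $V$, that is, $f(C)=l(C)$ for every vertex $C$. Moreover, for any two non-degenerate linear $[n,k]_q$ codes $C$ and $D$, some monomial semilinear automorphism of $V$ maps $C$ onto $D$ (i.e. $C$ and $D$ are semilinearly equivalent)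 if and only if some automorphism of $\Gamma(n,k)_q$ maps $C$ to $D$. -/

import Mathlib

attribute [local instance] RingHomInvPair.of_ringEquiv RingHomInvPair.of_ringEquiv_symm

/-- The Grassmann graph: its vertices are the `k`-dimensional subspaces of `V`, two of them being
adjacent when their intersection is `(k - 1)`-dimensional. -/
def grassmannGraph (K V : Type*) [Field K] [AddCommGroup V] [Module K V] (k : ℕ) :
    SimpleGraph {S : Submodule K V // Module.finrank K S = k} where
  Adj S T := Module.finrank K (S.1 ⊓ T.1 : Submodule K V) + 1 = k
  symm := ⟨fun S T h => by rw [inf_comm]; exact h⟩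
  loopless := ⟨fun S h => by rw [inf_idem, S.2] at h; omega⟩

/-- A linear code `C ⊆ F ^ n` is non-degenerate if the restriction of every coordinate functional
to `C` is non-zero. -/
def IsNondegenerateCode {F : Type*} [Field F] {n : ℕ} (C : Submodule F (Fin n → F)) : Prop :=
  ∀ i : Fin n, (LinearMap.proj i : (Fin n → F) →ₗ[F] F).domRestrict C ≠ 0

/-- The set of non-degenerate linear codes of length `n` and dimension `k` over `F`. -/
def nondegenerateCodes (F : Type*) [Field F] (n k : ℕ) :
    Set {C : Submodule F (Fin n → F) // Module.finrank F C = k} :=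
  {C | IsNondegenerateCode C.1}

/-- The restriction of the Grassmann graph of `F ^ n` to the non-degenerate linear codes. -/
def codeGraph (F : Type*) [Field F] (n k : ℕ) : SimpleGraph (nondegenerateCodes F n k) :=
  (grassmannGraph F (Fin n → F) k).induce (nondegenerateCodes F n k)

/-- A semilinear automorphism of `F ^ n` is monomial if it sends the vectors of the standard basis
to non-zero scalar multiples of the vectors of the standard basis, up to a permutation. -/
def IsMonomial {F : Type*} [Field F] {n : ℕ} {σ : F ≃+* F}
    (l : (Fin n → F) ≃ₛₗ[(σ : F →+* F)] (Fin n → F)) : Prop :=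
  ∃ (δ : Equiv.Perm (Fin n)) (a : Fin n → F), (∀ i, a i ≠ 0) ∧
    ∀ i, l (Pi.single i 1) = a i • (Pi.single (δ i) 1 : Fin n → F)

/-- Two linear codes are semilinearly equivalent if some monomial semilinear automorphism of `F ^ n`
transfers the first to the second. -/
def SemilinearlyEquivalent {F : Type*} [Field F] {n : ℕ}
    (C D : Submodule F (Fin n → F)) : Prop :=
  ∃ (σ : F ≃+* F) (l : (Fin n → F) ≃ₛₗ[(σ : F →+* F)] (Fin n → F)),
    IsMonomial l ∧ C.map (l : (Fin n → F) →ₛₗ[(σ : F →+* F)] (Fin n → F)) = D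

/-- The automorphism `f` of the graph of non-degenerate codes is induced by the semilinear
automorphism `l`: it sends every vertex `C` to `l(C)`. -/
def IsInducedBy {F : Type*} [Field F] {n k : ℕ} {σ : F ≃+* F}
    (f : codeGraph F n k ≃g codeGraph F n k)
    (l : (Fin n → F) ≃ₛₗ[(σ : F →+* F)] (Fin n → F)) : Prop :=
  ∀ C : nondegenerateCodes F n k,
    (f C).1.1 = C.1.1.map (l : (Fin n → F) →ₛₗ[(σ : F →+* F)] (Fin n → F))

/-! The dimension is lowered to two, and planes are then coordinatized. By `clique_star_or_top`, the
members of a clique share a subspace of one dimension less (a star) or lie in one of one dimension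
more (a top). Counting the degenerate subspaces shows that a star with non-degenerate centre goes to
another such star, so an automorphism on `(k + 1)`-dimensional codes induces one on `k`-dimensional
codes (`CodeAut.exists_lower`). If the induced one is monomial, dividing by its monomial map leaves
an automorphism whose value at `C` contains every `k`-dimensional code in `C`; such an automorphism
is the identity (`apply_eq_self_of_lower`).

For `k = 2` the induced action is on nowhere zero points, whose graph is complete and carries no
information, so incidence with planes is used. Stars centred at points with exactly one zero
coordinate go to stars of the same kind (`exists_onlyZeroAt_image`), and counting nowhere zero
points on a plane then shows that planes through some `e_i` go to planes through some `e_j`. The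
index `j` depends only on `i` (`exists_unitVec_perm`), so after a monomial correction the pencils of
`1` and of all `e_i` are preserved.

The planes through `1` are points of `F ^ n` modulo `1`, where the meaningful coordinates are the
ratios `(v k - v i) / (v j - v i)`. The automorphism transforms them by a single function,
independent of the indices, which is a field automorphism (`PreservesFrame.exists_ringEquiv`). Once
it is divided out, every plane through `1` is fixed. This spreads to planes through any nowhere zero
point by changing one coordinate at a time (`FixesPencil.of_one`), and then to all two-dimensional
codes (`apply_eq_self_of_fixesPencil`). -/

open Module Submodule

/-! ### Linear algebra and cliques of the Grassmann graph -/

section LinearAlgebra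

variable {F V : Type*} [Field F] [AddCommGroup V] [Module F V]

theorem finrank_sup_span_of_notMem [FiniteDimensional F V] {S : Submodule F V} {v : V}
    (hv : v ∉ S) : finrank F (S ⊔ span F {v} : Submodule F V) = finrank F S + 1 :=
  finrank_sup_span_singleton hv

theorem sup_span_le {S T : Submodule F V} {v : V} (h : S ≤ T) (hv : v ∈ T) :
    S ⊔ span F {v} ≤ T :=
  sup_le h ((span_singleton_le_iff_mem _ _).2 hv)

theorem mem_sup_span_self (S : Submodule F V) (v : V) : v ∈ S ⊔ span F {v} :=
  mem_sup_right (mem_span_singleton_self v)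

theorem mem_sup_span {S : Submodule F V} {v w : V} :
    w ∈ S ⊔ span F {v} ↔ ∃ s ∈ S, ∃ a : F, s + a • v = w := by
  simp only [mem_sup, mem_span_singleton]
  constructor
  · rintro ⟨s, hs, _, ⟨a, rfl⟩, h⟩
    exact ⟨s, hs, a, h⟩
  · rintro ⟨s, hs, a, h⟩
    exact ⟨s, hs, _, ⟨a, rfl⟩, h⟩

/-- Exchange: if `w ∈ S + v` is not in `S`, then `S + w = S + v`. -/
theorem sup_span_eq_of_mem [FiniteDimensional F V] {S C : Submodule F V} {w : V} (hS : S ≤ C)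
    (hC : finrank F C = finrank F S + 1) (hw : w ∈ C) (hwS : w ∉ S) : S ⊔ span F {w} = C :=
  eq_of_le_of_finrank_eq (sup_span_le hS hw) (by rw [finrank_sup_span_of_notMem hwS, hC])

theorem span_pair_eq_sup (x v : V) : span F {x, v} = span F {x} ⊔ span F {v} := by
  rw [span_insert]

theorem finrank_span_pair [FiniteDimensional F V] {x v : V} (hx : x ≠ 0) (hv : v ∉ span F {x}) :
    finrank F (span F {x, v}) = 2 := by
  rw [span_pair_eq_sup, finrank_sup_span_of_notMem hv, finrank_span_singleton hx]

theorem eq_span_pair [FiniteDimensional F V] {C : Submodule F V} (hC : finrank F C = 2) {x v : V}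
    (hx : x ≠ 0) (hxC : x ∈ C) (hvC : v ∈ C) (hv : v ∉ span F {x}) : C = span F {x, v} := by
  refine (eq_of_le_of_finrank_eq ?_ ?_).symm
  · rw [span_le]
    rintro y (rfl | rfl)
    exacts [hxC, hvC]
  · rw [finrank_span_pair hx hv, hC]

theorem exists_mem_notMem_of_finrank_lt [FiniteDimensional F V] {S T : Submodule F V}
    (h : finrank F S < finrank F T) : ∃ v ∈ T, v ∉ S := by
  by_contra! hc
  exact absurd (finrank_mono (show T ≤ S from hc)) (not_le.2 h)

theorem exists_between_finrank [FiniteDimensional F V] {W C : Submodule F V} (h : W ≤ C) {m : ℕ}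
    (h1 : finrank F W ≤ m) (h2 : m ≤ finrank F C) :
    ∃ S : Submodule F V, W ≤ S ∧ S ≤ C ∧ finrank F S = m := by
  induction m, h1 using Nat.le_induction with
  | base => exact ⟨W, le_rfl, h, rfl⟩
  | succ m _ ih =>
    obtain ⟨S, hWS, hSC, hS⟩ := ih (by omega)
    obtain ⟨v, hvC, hvS⟩ := exists_mem_notMem_of_finrank_lt (S := S) (T := C) (by omega)
    exact ⟨S ⊔ span F {v}, hWS.trans le_sup_left, sup_span_le hSC hvC, by
      rw [finrank_sup_span_of_notMem hvS, hS]⟩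

/-- A hyperplane of `C` containing `W` and missing `c`. -/
theorem exists_hyperplane [FiniteDimensional F V] {W C : Submodule F V} (h : W ≤ C) {c : V}
    (hc : c ∈ C) (hcW : c ∉ W) :
    ∃ D : Submodule F V, W ≤ D ∧ D ≤ C ∧ c ∉ D ∧ finrank F D + 1 = finrank F C := by
  obtain ⟨φ, hφ, hW⟩ := Submodule.exists_le_ker_of_notMem hcW
  have hker : finrank F (LinearMap.ker φ ⊓ C : Submodule F V) + 1 = finrank F C := by
    have h1 := LinearMap.finrank_range_add_finrank_ker (φ.domRestrict C)
    have h2 : finrank F (LinearMap.range (φ.domRestrict C)) = 1 := by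
      have : LinearMap.range (φ.domRestrict C) = ⊤ := by
        refine LinearMap.range_eq_top.2 (LinearMap.surjective ?_)
        intro h0
        exact hφ (by simpa using LinearMap.congr_fun h0 ⟨c, hc⟩)
      rw [this, finrank_top, finrank_self]
    have h3 : finrank F (LinearMap.ker (φ.domRestrict C)) =
        finrank F (LinearMap.ker φ ⊓ C : Submodule F V) := by
      have : LinearMap.ker (φ.domRestrict C) = (LinearMap.ker φ).comap C.subtype := rfl
      rw [this, ← finrank_map_subtype_eq C, map_comap_subtype, inf_comm]
    omega
  exact ⟨LinearMap.ker φ ⊓ C, le_inf hW h, inf_le_right, fun hm => hφ (by simpa using hm.1), hker⟩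

theorem finrank_inf_lt_of_ne [FiniteDimensional F V] {A B : Submodule F V}
    (h : finrank F A = finrank F B) (hne : A ≠ B) :
    finrank F (A ⊓ B : Submodule F V) < finrank F A := by
  refine finrank_lt_finrank_of_lt (lt_of_le_of_ne inf_le_left fun he => hne ?_)
  exact eq_of_le_of_finrank_eq (inf_eq_left.1 he) h

/-- A family of pairwise adjacent `k`-dimensional subspaces with at least two members is contained
in a star or in a top of the Grassmann graph. -/
theorem clique_star_or_top [FiniteDimensional F V] {k : ℕ} {𝒦 : Set (Submodule F V)}
    (hk : ∀ C ∈ 𝒦, finrank F C = k)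
    (hadj : ∀ C ∈ 𝒦, ∀ D ∈ 𝒦, C ≠ D → finrank F (C ⊓ D : Submodule F V) + 1 = k)
    {A B : Submodule F V} (hA : A ∈ 𝒦) (hB : B ∈ 𝒦) (hAB : A ≠ B) :
    (∃ S : Submodule F V, finrank F S + 1 = k ∧ ∀ C ∈ 𝒦, S ≤ C) ∨
      ∃ U : Submodule F V, finrank F U = k + 1 ∧ ∀ C ∈ 𝒦, C ≤ U := by
  have hS := hadj A hA B hB hAB
  have hU : finrank F (A ⊔ B : Submodule F V) = k + 1 := by
    have := finrank_sup_add_finrank_inf_eq A B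
    rw [hk A hA, hk B hB] at this
    omega
  -- If `C` is not inside `A ⊔ B`, then `C ⊓ (A ⊔ B)` has dimension at most `k - 1`, hence equals
  -- both `C ⊓ A` and `C ⊓ B`; so it is `A ⊓ B`.
  have key : ∀ C ∈ 𝒦, A ⊓ B ≤ C ∨ C ≤ A ⊔ B := by
    intro C hC
    by_contra! hcon
    have hCA : C ≠ A := fun h => hcon.2 (h ▸ le_sup_left)
    have hCB : C ≠ B := fun h => hcon.2 (h ▸ le_sup_right)
    have h1 := hadj C hC A hA hCA
    have h2 := hadj C hC B hB hCB
    have hlt : finrank F (C ⊓ (A ⊔ B) : Submodule F V) < finrank F C :=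
      finrank_lt_finrank_of_lt (lt_of_le_of_ne inf_le_left fun he => hcon.2 (inf_eq_left.1 he))
    rw [hk C hC] at hlt
    have e1 : C ⊓ A = C ⊓ (A ⊔ B) :=
      eq_of_le_of_finrank_le (inf_le_inf_left _ le_sup_left) (by omega)
    have e2 : C ⊓ B = C ⊓ (A ⊔ B) :=
      eq_of_le_of_finrank_le (inf_le_inf_left _ le_sup_right) (by omega)
    have e3 : C ⊓ A ≤ A ⊓ B := le_inf inf_le_right ((e1.trans e2.symm).le.trans inf_le_right)
    have e4 : C ⊓ A = A ⊓ B := eq_of_le_of_finrank_le e3 (by omega)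
    exact hcon.1 (e4 ▸ inf_le_left)
  by_cases hall : ∀ C ∈ 𝒦, A ⊓ B ≤ C
  · exact Or.inl ⟨_, hS, hall⟩
  · right
    push Not at hall
    obtain ⟨C, hC, hSC⟩ := hall
    have hCU := (key C hC).resolve_left hSC
    -- A member `D` outside `A ⊔ B` meets it exactly in `A ⊓ B`. As `C ≤ A ⊔ B`, also `D ⊓ C = A ⊓
    -- B`, which would put `A ⊓ B` inside `C`.
    refine ⟨_, hU, fun D hD => (key D hD).elim (fun hSD => ?_) id⟩
    by_contra hDU
    have hDC : D ≠ C := fun h => hDU (h ▸ hCU)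
    have h1 := hadj D hD C hC hDC
    have hlt : finrank F (D ⊓ (A ⊔ B) : Submodule F V) < finrank F D :=
      finrank_lt_finrank_of_lt (lt_of_le_of_ne inf_le_left fun he => hDU (inf_eq_left.1 he))
    rw [hk D hD] at hlt
    have e1 : A ⊓ B = D ⊓ (A ⊔ B) :=
      eq_of_le_of_finrank_le (le_inf hSD (inf_le_left.trans le_sup_left)) (by omega)
    have e2 : D ⊓ C = A ⊓ B :=
      eq_of_le_of_finrank_le (e1 ▸ inf_le_inf_left _ hCU) (by omega)
    exact hSC (e2 ▸ inf_le_right)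

/-- Two distinct members of the star of `S` meet in `S`. -/
theorem inf_eq_of_star [FiniteDimensional F V] {S A B : Submodule F V}
    (hA : finrank F A = finrank F S + 1) (hB : finrank F B = finrank F S + 1)
    (hSA : S ≤ A) (hSB : S ≤ B) (hne : A ≠ B) : A ⊓ B = S := by
  have h := finrank_inf_lt_of_ne (hA.trans hB.symm) hne
  exact (eq_of_le_of_finrank_le (le_inf hSA hSB) (by omega)).symm

theorem ncard_eq_pow_finrank [FiniteDimensional F V] (S : Submodule F V) :
    (S : Set V).ncard = Nat.card F ^ finrank F S := by
  rw [← Module.natCard_eq_pow_finrank (K := F) (V := S)]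
  rfl

end LinearAlgebra

/-! ### Counting points and hyperplanes -/

section Counting

variable {F V : Type*} [Field F] [Finite F] [AddCommGroup V] [Module F V]

/-- The number of points of a projective space of vector space dimension `d` and order `q`. -/
def pointCount (q d : ℕ) : ℕ := ∑ i ∈ Finset.range d, q ^ i

theorem pointCount_succ (q d : ℕ) : pointCount q (d + 1) = pointCount q d + q ^ d :=
  Finset.sum_range_succ _ _

theorem pointCount_mono (q : ℕ) {d e : ℕ} (h : d ≤ e) : pointCount q d ≤ pointCount q e :=
  Finset.sum_le_sum_of_subset (Finset.range_mono h)

/-- The number of subspaces of dimension `dim S + 1` between `S` and `U`. -/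
theorem ncard_interval [FiniteDimensional F V] {S U : Submodule F V} (hSU : S ≤ U) :
    {C : Submodule F V | S ≤ C ∧ C ≤ U ∧ finrank F C = finrank F S + 1}.ncard =
      pointCount (Nat.card F) (finrank F U - finrank F S) := by
  classical
  have : Finite V := Module.finite_of_finite F
  have : Fintype V := Fintype.ofFinite V
  set 𝒜 := {C : Submodule F V | S ≤ C ∧ C ≤ U ∧ finrank F C = finrank F S + 1}
  have hfin : 𝒜.Finite := Set.toFinite _
  set q := Nat.card F
  have hq : 1 < q := Finite.one_lt_card
  have hdiff : ∀ {A : Submodule F V}, S ≤ A →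
      ((A : Set V) \ S).ncard + q ^ finrank F S = q ^ finrank F A := by
    intro A hA
    rw [← ncard_eq_pow_finrank, ← ncard_eq_pow_finrank]
    exact Set.ncard_sdiff_add_ncard_of_subset hA (Set.toFinite _)
  -- The vectors of `U` outside `S` are sorted by the subspace `S + w` they generate with `S`; each
  -- fibre is `C \ S`, of constant size.
  have hcount : ((U : Set V) \ S).toFinset.card =
      ∑ C ∈ hfin.toFinset, (((C : Set V) \ S).toFinset).card := by
    rw [Finset.card_eq_sum_card_fiberwise (f := fun w => S ⊔ span F {w}) (t := hfin.toFinset)]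
    · refine Finset.sum_congr rfl fun C hC => ?_
      obtain ⟨hSC, hCU, hfC⟩ := hfin.mem_toFinset.1 hC
      congr 1
      ext w
      simp only [Finset.mem_filter, Set.mem_toFinset, Set.mem_sdiff, SetLike.mem_coe]
      constructor
      · rintro ⟨⟨_, h2⟩, rfl⟩
        exact ⟨mem_sup_span_self _ _, h2⟩
      · rintro ⟨h1, h2⟩
        exact ⟨⟨hCU h1, h2⟩, sup_span_eq_of_mem hSC hfC h1 h2⟩
    · intro w hw
      simp only [Set.coe_toFinset, Set.mem_sdiff, SetLike.mem_coe] at hw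
      simp only [Set.Finite.coe_toFinset]
      exact ⟨le_sup_left, sup_span_le hSU hw.1, finrank_sup_span_of_notMem hw.2⟩
  rw [Finset.sum_congr rfl (g := fun _ => q ^ (finrank F S + 1) - q ^ finrank F S)] at hcount
  · rw [Finset.sum_const, smul_eq_mul, ← Set.ncard_eq_toFinset_card _ hfin,
      ← Set.ncard_eq_toFinset_card'] at hcount
    have h1 := hdiff hSU
    have hm : finrank F S ≤ finrank F U := finrank_mono hSU
    obtain ⟨e, he⟩ := Nat.exists_eq_add_of_le hm
    rw [hcount, he] at h1
    rw [he, Nat.add_sub_cancel_left]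
    obtain ⟨r, hr⟩ : ∃ r, q = r + 1 := ⟨q - 1, by omega⟩
    have h2 : q ^ (finrank F S + 1) - q ^ finrank F S = q ^ finrank F S * r := by
      rw [pow_succ, hr]
      rw [mul_add, mul_one, Nat.add_sub_cancel]
    -- The geometric series without subtraction: `r` stands for `q - 1`.
    have h4 : pointCount q e * r + 1 = q ^ e := by
      clear h1 he hcount hm
      induction e with
      | zero => simp [pointCount]
      | succ e ih => rw [pointCount_succ, add_mul, add_right_comm, ih, pow_succ, hr]; ring
    rw [h2, pow_add, ← h4] at h1
    have hpos : 0 < q ^ finrank F S * r := Nat.mul_pos (by positivity) (by omega)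
    exact Nat.eq_of_mul_eq_mul_right hpos (by nlinarith)
  · intro C hC
    obtain ⟨hSC, hCU, hfC⟩ := hfin.mem_toFinset.1 hC
    have := hdiff hSC
    rw [hfC] at this
    rw [← Set.ncard_eq_toFinset_card']
    omega

/-- The number of hyperplanes of `U`. -/
theorem ncard_hyperplanes [FiniteDimensional F V] {U : Submodule F V} {k : ℕ}
    (hU : finrank F U = k + 1) :
    {C : Submodule F V | C ≤ U ∧ finrank F C = k}.ncard = pointCount (Nat.card F) (k + 1) := by
  -- Hyperplanes of `U` correspond to points of its dual through the annihilator.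
  have h1 := ncard_interval (F := F) (V := Dual F U) (S := ⊥) (U := ⊤) bot_le
  rw [finrank_top, Subspace.dual_finrank_eq, finrank_bot, hU, Nat.sub_zero] at h1
  rw [← h1]
  refine Set.ncard_congr (fun C _ => (C.comap U.subtype).dualAnnihilator) ?_ ?_ ?_
  · rintro C ⟨hC, hk⟩
    have h2 := Subspace.finrank_add_finrank_dualAnnihilator_eq (C.comap U.subtype)
    have h3 : finrank F (C.comap U.subtype) = k := by
      rw [← hk, ← finrank_map_subtype_eq U, map_comap_subtype, inf_eq_right.2 hC]
    exact ⟨bot_le, le_top, by omega⟩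
  · rintro A B ⟨hA, -⟩ ⟨hB, -⟩ h
    have h2 := Subspace.dualAnnihilator_inj.1 h
    have h3 := congrArg (Submodule.map U.subtype) h2
    rwa [map_comap_subtype, map_comap_subtype, inf_eq_right.2 hA, inf_eq_right.2 hB] at h3
  · rintro L ⟨-, -, hL⟩
    refine ⟨L.dualCoannihilator.map U.subtype, ⟨map_subtype_le _ _, ?_⟩, ?_⟩
    · rw [finrank_map_subtype_eq]
      have := Subspace.finrank_add_finrank_dualCoannihilator_eq L
      omega
    · rw [comap_map_eq_of_injective U.injective_subtype, Subspace.dualCoannihilator_dualAnnihilator_eq]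

end Counting

/-! ### Non-degenerate codes and the passage from dimension `k + 1` to `k` -/

section Codes

variable {F : Type*} [Field F] {n k : ℕ}

/-- `C` is a non-degenerate code of dimension `k`. -/
def IsCode (k : ℕ) (C : Submodule F (Fin n → F)) : Prop :=
  finrank F C = k ∧ ∀ i, ∃ x ∈ C, x i ≠ 0

theorem isNondegenerateCode_iff {C : Submodule F (Fin n → F)} :
    IsNondegenerateCode C ↔ ∀ i, ∃ x ∈ C, x i ≠ 0 := by
  refine forall_congr' fun i => ?_
  rw [← not_iff_not, not_not]
  push Not
  constructor
  · intro h x hx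
    simpa using LinearMap.congr_fun h ⟨x, hx⟩
  · intro h
    ext ⟨x, hx⟩
    simpa using h x hx

/-- The `i`-th coordinate hyperplane. -/
def coordHyperplane (F : Type*) [Field F] {n : ℕ} (i : Fin n) : Submodule F (Fin n → F) :=
  LinearMap.ker (LinearMap.proj i)

@[simp] theorem mem_coordHyperplane {i : Fin n} {x : Fin n → F} :
    x ∈ coordHyperplane F i ↔ x i = 0 := Iff.rfl

theorem finrank_coordHyperplane (i : Fin n) : finrank F (coordHyperplane F i) + 1 = n := by
  have h1 := LinearMap.finrank_range_add_finrank_ker (LinearMap.proj i : (Fin n → F) →ₗ[F] F)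
  rw [LinearMap.range_eq_top.2 (LinearMap.proj_surjective i), finrank_top, finrank_self,
    finrank_fin_fun] at h1
  rw [coordHyperplane]
  omega

theorem finrank_inf_coordHyperplane {C : Submodule F (Fin n → F)} {i : Fin n} {x : Fin n → F}
    (hx : x ∈ C) (hxi : x i ≠ 0) :
    finrank F (C ⊓ coordHyperplane F i : Submodule F (Fin n → F)) + 1 = finrank F C := by
  have h1 := finrank_sup_add_finrank_inf_eq C (coordHyperplane F i)
  have h2 := finrank_coordHyperplane (F := F) i
  have h3 : finrank F (C ⊔ coordHyperplane F i : Submodule F (Fin n → F)) = n := by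
    have hle := finrank_mono (sup_le (le_sup_right (a := C))
      ((span_singleton_le_iff_mem _ _).2 (mem_sup_left (T := coordHyperplane F i) hx)))
    rw [finrank_sup_span_of_notMem hxi] at hle
    have := Submodule.finrank_le (C ⊔ coordHyperplane F i)
    rw [finrank_fin_fun] at this
    omega
  omega

theorem IsCode.of_le {C D : Submodule F (Fin n → F)} {l : ℕ} (hC : IsCode l C) (h : C ≤ D)
    (hD : finrank F D = k) : IsCode k D :=
  ⟨hD, fun i => let ⟨x, hx, hxi⟩ := hC.2 i; ⟨x, h hx, hxi⟩⟩

theorem IsCode.not_le {C : Submodule F (Fin n → F)} (hC : IsCode k C) (i : Fin n) :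
    ¬ C ≤ coordHyperplane F i := fun h =>
  let ⟨_, hx, hxi⟩ := hC.2 i
  hxi (h hx)

theorem exists_le_coordHyperplane {C : Submodule F (Fin n → F)} (hd : finrank F C = k)
    (hC : ¬ IsCode k C) : ∃ i, C ≤ coordHyperplane F i := by
  by_contra! h
  exact hC ⟨hd, fun i => SetLike.not_le_iff_exists.1 (h i)⟩

/-- An automorphism of the graph of non-degenerate codes, as a map on all subspaces. -/
structure CodeAut (F : Type*) [Field F] (n k : ℕ) where
  toFun : Submodule F (Fin n → F) → Submodule F (Fin n → F)
  invFun : Submodule F (Fin n → F) → Submodule F (Fin n → F)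
  map_code : ∀ {C}, IsCode k C → IsCode k (toFun C)
  inv_code : ∀ {C}, IsCode k C → IsCode k (invFun C)
  left_inv : ∀ {C}, IsCode k C → invFun (toFun C) = C
  right_inv : ∀ {C}, IsCode k C → toFun (invFun C) = C
  map_adj : ∀ {C D}, IsCode k C → IsCode k D →
    finrank F (C ⊓ D : Submodule F (Fin n → F)) + 1 = k →
    finrank F (toFun C ⊓ toFun D : Submodule F (Fin n → F)) + 1 = k
  inv_adj : ∀ {C D}, IsCode k C → IsCode k D →
    finrank F (C ⊓ D : Submodule F (Fin n → F)) + 1 = k →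
    finrank F (invFun C ⊓ invFun D : Submodule F (Fin n → F)) + 1 = k

namespace CodeAut

instance : CoeFun (CodeAut F n k) fun _ => Submodule F (Fin n → F) → Submodule F (Fin n → F) :=
  ⟨toFun⟩

/-- The inverse automorphism. -/
def symm (f : CodeAut F n k) : CodeAut F n k where
  toFun := f.invFun
  invFun := f.toFun
  map_code := f.inv_code
  inv_code := f.map_code
  left_inv := f.right_inv
  right_inv := f.left_inv
  map_adj := f.inv_adj
  inv_adj := f.map_adj

/-- The composition `g ∘ f`. -/
def comp (g f : CodeAut F n k) : CodeAut F n k where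
  toFun C := g (f C)
  invFun C := f.symm (g.symm C)
  map_code h := g.map_code (f.map_code h)
  inv_code h := f.inv_code (g.inv_code h)
  left_inv h := by
    change f.invFun (g.invFun (g (f _))) = _
    rw [g.left_inv (f.map_code h), f.left_inv h]
  right_inv h := by
    change g (f (f.invFun (g.invFun _))) = _
    rw [f.right_inv (g.inv_code h), g.right_inv h]
  map_adj hC hD h := g.map_adj (f.map_code hC) (f.map_code hD) (f.map_adj hC hD h)
  inv_adj hC hD h := f.inv_adj (g.inv_code hC) (g.inv_code hD) (g.inv_adj hC hD h)

@[simp] theorem comp_apply (g f : CodeAut F n k) (C : Submodule F (Fin n → F)) :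
    g.comp f C = g (f C) := rfl

theorem symm_apply_apply (f : CodeAut F n k) {C : Submodule F (Fin n → F)} (hC : IsCode k C) :
    f.symm (f C) = C := f.left_inv hC

theorem apply_symm_apply (f : CodeAut F n k) {C : Submodule F (Fin n → F)} (hC : IsCode k C) :
    f (f.symm C) = C := f.right_inv hC

theorem injOn (f : CodeAut F n k) {C D : Submodule F (Fin n → F)} (hC : IsCode k C)
    (hD : IsCode k D) (h : f C = f D) : C = D := by
  rw [← f.symm_apply_apply hC, h, f.symm_apply_apply hD]

end CodeAut

/-- A non-degenerate code adjacent or equal to all members of a non-degenerate star belongs to it. -/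
theorem le_of_adj_star (hkn : k + 2 < n) {S C : Submodule F (Fin n → F)} (hS : IsCode k S)
    (hC : IsCode (k + 1) C)
    (h : ∀ D, IsCode (k + 1) D → S ≤ D → C ≠ D →
      finrank F (C ⊓ D : Submodule F (Fin n → F)) + 1 = k + 1) : S ≤ C := by
  by_contra hSC
  -- Here `C ⊓ D` and `S` are different hyperplanes of `D`, so they span it and `D ≤ S ⊔ C`. This
  -- space has dimension at most `k + 2 < n`, and a vector outside it gives a star member that
  -- violates the inclusion.
  have key : ∀ D, IsCode (k + 1) D → S ≤ D →
      D ≤ S ⊔ C ∧ finrank F (S ⊔ C : Submodule F (Fin n → F)) ≤ k + 2 := by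
    intro D hD hSD
    have h1 := h D hD hSD (fun he => hSC (he ▸ hSD))
    have h2 : finrank F (S ⊔ C ⊓ D : Submodule F (Fin n → F)) = finrank F D := by
      refine le_antisymm (finrank_mono (sup_le hSD inf_le_right)) ?_
      have hlt : finrank F S < finrank F (S ⊔ C ⊓ D : Submodule F (Fin n → F)) := by
        refine finrank_lt_finrank_of_lt (lt_of_le_of_ne le_sup_left fun he => hSC ?_)
        have h3 : C ⊓ D ≤ S := he ▸ le_sup_right
        have h4 := eq_of_le_of_finrank_eq h3 (by rw [hS.1]; omega)
        exact h4 ▸ inf_le_left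
      rw [hS.1] at hlt
      rw [hD.1]
      omega
    have h3 : D ≤ S ⊔ C := by
      rw [← eq_of_le_of_finrank_eq (sup_le hSD inf_le_right) h2]
      exact sup_le_sup_left inf_le_left _
    have h4 := finrank_sup_add_finrank_inf_eq C D
    rw [hC.1, hD.1] at h4
    have h5 := finrank_mono (sup_le (hSD.trans le_sup_right) le_sup_left : S ⊔ C ≤ C ⊔ D)
    exact ⟨h3, by omega⟩
  have hex : ∀ T : Submodule F (Fin n → F), finrank F T < n → ∃ v, v ∉ T := by
    intro T hT
    obtain ⟨v, -, hv⟩ := exists_mem_notMem_of_finrank_lt (S := T) (T := ⊤) (by simpa using hT)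
    exact ⟨v, hv⟩
  have hstar : ∀ v, v ∉ S → IsCode (k + 1) (S ⊔ span F {v}) := fun v hv =>
    hS.of_le le_sup_left (by rw [finrank_sup_span_of_notMem hv, hS.1])
  obtain ⟨u, hu⟩ := hex S (by rw [hS.1]; omega)
  have h1 := (key _ (hstar u hu) le_sup_left).2
  obtain ⟨v, hv⟩ := hex (S ⊔ C) (by omega)
  exact hv ((key _ (hstar v fun h => hv (mem_sup_left h)) le_sup_left).1 (mem_sup_span_self _ _))

/-- The star determines its centre, since two of its members already meet in `S`; the bound on `n`
provides two members. -/
theorem eq_of_le_star (hkn : k + 2 ≤ n) {S T : Submodule F (Fin n → F)} (hS : IsCode k S)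
    (hT : IsCode k T) (h : ∀ C, IsCode (k + 1) C → S ≤ C → T ≤ C) : T = S := by
  have hex : ∀ T : Submodule F (Fin n → F), finrank F T < n → ∃ v, v ∉ T := by
    intro T hT
    obtain ⟨v, -, hv⟩ := exists_mem_notMem_of_finrank_lt (S := T) (T := ⊤) (by simpa using hT)
    exact ⟨v, hv⟩
  have hstar : ∀ v, v ∉ S → IsCode (k + 1) (S ⊔ span F {v}) := fun v hv =>
    hS.of_le le_sup_left (by rw [finrank_sup_span_of_notMem hv, hS.1])
  obtain ⟨u, hu⟩ := hex S (by rw [hS.1]; omega)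
  obtain ⟨v, hv⟩ := hex (S ⊔ span F {u}) (by rw [(hstar u hu).1]; omega)
  have hvS : v ∉ S := fun h => hv (mem_sup_left h)
  have hu' := hstar u hu
  have hv' := hstar v hvS
  have hne : S ⊔ span F {u} ≠ S ⊔ span F {v} := fun he => hv (by
    rw [he]
    exact mem_sup_span_self S v)
  have hinf : (S ⊔ span F {u}) ⊓ (S ⊔ span F {v}) = S :=
    inf_eq_of_star (by rw [hu'.1, hS.1]) (by rw [hv'.1, hS.1]) le_sup_left le_sup_left hne
  refine eq_of_le_of_finrank_eq ?_ (by rw [hS.1, hT.1])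
  rw [← hinf]
  exact le_inf (h _ hu' le_sup_left) (h _ hv' le_sup_left)

/-- Expresses adjacency in dimension `k` by incidence with codes of dimension `k + 1`, so that a
bijection preserving this incidence preserves adjacency. -/
theorem adj_iff_exists_code {S T : Submodule F (Fin n → F)} (hS : IsCode k S)
    (hT : IsCode k T) : finrank F (S ⊓ T : Submodule F (Fin n → F)) + 1 = k ↔
      S ≠ T ∧ ∃ C, IsCode (k + 1) C ∧ S ≤ C ∧ T ≤ C := by
  have h1 := finrank_sup_add_finrank_inf_eq S T
  rw [hS.1, hT.1] at h1
  constructor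
  · intro h
    refine ⟨?_, S ⊔ T, hS.of_le le_sup_left (by omega), le_sup_left, le_sup_right⟩
    rintro rfl
    rw [inf_idem, hS.1] at h
    omega
  · rintro ⟨hne, C, hC, hSC, hTC⟩
    have h2 := finrank_mono (sup_le hSC hTC)
    have h3 := finrank_inf_lt_of_ne (hS.1.trans hT.1.symm) hne
    rw [hC.1] at h2
    rw [hS.1] at h3
    omega

variable [Finite F]

theorem ncard_star {S : Submodule F (Fin n → F)} (hS : IsCode k S) :
    {C : Submodule F (Fin n → F) | IsCode (k + 1) C ∧ S ≤ C}.ncard =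
      pointCount (Nat.card F) (n - k) := by
  have h := ncard_interval (S := S) (U := ⊤) le_top
  rw [finrank_top, finrank_fin_fun, hS.1] at h
  rw [← h]
  congr 1
  ext C
  exact ⟨fun ⟨h1, h2⟩ => ⟨h2, le_top, h1.1⟩, fun ⟨h1, _, h2⟩ => ⟨hS.of_le h1 h2, h1⟩⟩

/-- A degenerate `S` lies in a coordinate hyperplane, which also contains some `(k + 1)`-dimensional
space through `S`; that space is not counted. -/
theorem ncard_star_lt {S : Submodule F (Fin n → F)} (hkn : k + 2 ≤ n) (hd : finrank F S = k)
    (hS : ¬ IsCode k S) :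
    {C : Submodule F (Fin n → F) | IsCode (k + 1) C ∧ S ≤ C}.ncard <
      pointCount (Nat.card F) (n - k) := by
  have h := ncard_interval (S := S) (U := ⊤) le_top
  rw [finrank_top, finrank_fin_fun, hd] at h
  rw [← h]
  obtain ⟨i, hi⟩ := exists_le_coordHyperplane hd hS
  have hfi := finrank_coordHyperplane (F := F) i
  obtain ⟨C, hSC, hC, hCd⟩ := exists_between_finrank hi (m := k + 1) (by omega) (by omega)
  refine Set.ncard_lt_ncard ⟨fun D hD => ⟨hD.2, le_top, hD.1.1⟩, fun hsub => ?_⟩ (Set.toFinite _)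
  exact (hsub (show C ∈ _ from ⟨hSC, le_top, hCd⟩)).1.not_le i hC

/-- At least one hyperplane of `U` lies in a given coordinate hyperplane and is lost. -/
theorem ncard_top_lt {U : Submodule F (Fin n → F)} (hn : 0 < n) (hU : finrank F U = k + 1) :
    {C : Submodule F (Fin n → F) | IsCode k C ∧ C ≤ U}.ncard <
      pointCount (Nat.card F) (k + 1) := by
  rw [← ncard_hyperplanes hU]
  let i : Fin n := ⟨0, hn⟩
  have h1 := finrank_sup_add_finrank_inf_eq U (coordHyperplane F i)
  have h2 := finrank_coordHyperplane (F := F) i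
  have h3 : finrank F (U ⊔ coordHyperplane F i : Submodule F (Fin n → F)) ≤ n := by
    simpa using Submodule.finrank_le (U ⊔ coordHyperplane F i)
  obtain ⟨C, -, hC, hCd⟩ := exists_between_finrank
    (bot_le : ⊥ ≤ U ⊓ coordHyperplane F i) (m := k) (by simp) (by omega)
  refine Set.ncard_lt_ncard ⟨fun D hD => ⟨hD.2, hD.1.1⟩, fun hsub => ?_⟩ (Set.toFinite _)
  exact (hsub (show C ∈ _ from ⟨hC.trans inf_le_left, hCd⟩)).1.not_le i (hC.trans inf_le_right)

/-- The only degenerate hyperplanes of `U` are its intersections with the `n` coordinate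
hyperplanes. -/
theorem le_ncard_top {U : Submodule F (Fin n → F)} (hU : finrank F U = k + 1)
    (hUn : ∀ i, ∃ x ∈ U, x i ≠ 0) :
    pointCount (Nat.card F) (k + 1) ≤
      {C : Submodule F (Fin n → F) | IsCode k C ∧ C ≤ U}.ncard + n := by
  rw [← ncard_hyperplanes hU]
  have hsub : {C : Submodule F (Fin n → F) | C ≤ U ∧ finrank F C = k} ⊆
      {C | IsCode k C ∧ C ≤ U} ∪ Set.range fun i => U ⊓ coordHyperplane F i := by
    rintro C ⟨hCU, hC⟩
    by_cases h : IsCode k C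
    · exact Or.inl ⟨h, hCU⟩
    · obtain ⟨i, hi⟩ := exists_le_coordHyperplane hC h
      obtain ⟨x, hx, hxi⟩ := hUn i
      have := finrank_inf_coordHyperplane hx hxi
      exact Or.inr ⟨i, (eq_of_le_of_finrank_eq (le_inf hCU hi) (by omega)).symm⟩
  refine (Set.ncard_le_ncard hsub (Set.toFinite _)).trans ((Set.ncard_union_le _ _).trans ?_)
  gcongr
  rw [← Set.image_univ]
  refine (Set.ncard_image_le (Set.toFinite _)).trans ?_
  simp [Set.ncard_univ]

/-- The image of the star is a clique of known size. A star with degenerate centre is too small to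
contain it, and a top containing it would have to equal it, which the bounds on the size of a top
exclude. -/
theorem CodeAut.exists_star_image (f : CodeAut F n (k + 1)) (hk : 1 ≤ k) (hkn : k + 2 < n)
    {S : Submodule F (Fin n → F)} (hS : IsCode k S) :
    ∃ S', IsCode k S' ∧ ∀ C, IsCode (k + 1) C → S ≤ C → S' ≤ f C := by
  have hq : 1 < Nat.card F := Finite.one_lt_card
  set 𝒮 := {C : Submodule F (Fin n → F) | IsCode (k + 1) C ∧ S ≤ C}
  have h𝒮 : 𝒮.ncard = pointCount (Nat.card F) (n - k) := ncard_star hS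
  have hinj : Set.InjOn f 𝒮 := fun C hC D hD h => f.injOn hC.1 hD.1 h
  have hcard : (f '' 𝒮).ncard = pointCount (Nat.card F) (n - k) := by
    rw [hinj.ncard_image, h𝒮]
  obtain ⟨A, hA, B, hB, hAB⟩ := (Set.one_lt_ncard (s := 𝒮) (Set.toFinite _)).1 (by
    rw [h𝒮]
    refine lt_of_lt_of_le ?_ (pointCount_mono (Nat.card F) (show 2 ≤ n - k by omega))
    simp [pointCount, Finset.sum_range_succ])
  have hadj𝒮 : ∀ C ∈ 𝒮, ∀ D ∈ 𝒮, C ≠ D →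
      finrank F (C ⊓ D : Submodule F (Fin n → F)) + 1 = k + 1 := by
    intro C hC D hD hne
    rw [inf_eq_of_star (by rw [hC.1.1, hS.1]) (by rw [hD.1.1, hS.1]) hC.2 hD.2 hne, hS.1]
  rcases clique_star_or_top (𝒦 := f '' 𝒮) (k := k + 1)
    (by rintro _ ⟨C, hC, rfl⟩; exact (f.map_code hC.1).1)
    (by
      rintro _ ⟨C, hC, rfl⟩ _ ⟨D, hD, rfl⟩ hne
      exact f.map_adj hC.1 hD.1 (hadj𝒮 C hC D hD fun h => hne (h ▸ rfl)))
    ⟨A, hA, rfl⟩ ⟨B, hB, rfl⟩ (fun h => hAB (f.injOn hA.1 hB.1 h)) with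
    ⟨S', hS', hall⟩ | ⟨U, hU, hall⟩
  · refine ⟨S', ?_, fun C hC hSC => hall _ ⟨C, ⟨hC, hSC⟩, rfl⟩⟩
    by_contra hdeg
    have h1 := ncard_star_lt (by omega) (by omega) hdeg
    have h2 := Set.ncard_le_ncard (s := f '' 𝒮)
      (t := {C : Submodule F (Fin n → F) | IsCode (k + 1) C ∧ S' ≤ C})
      (by rintro _ ⟨C, hC, rfl⟩; exact ⟨f.map_code hC.1, hall _ ⟨C, hC, rfl⟩⟩) (Set.toFinite _)
    omega
  · exfalso
    -- Codes in a common top are pairwise adjacent, so the preimage of a further code in `U` is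
    -- adjacent to the whole star of `S`, and `le_of_adj_star` puts it in the star.
    have htop : {C : Submodule F (Fin n → F) | IsCode (k + 1) C ∧ C ≤ U} = f '' 𝒮 := by
      ext E
      constructor
      · rintro ⟨hE, hEU⟩
        refine ⟨f.symm E, ⟨f.inv_code hE, le_of_adj_star hkn hS (f.inv_code hE) ?_⟩,
          f.apply_symm_apply hE⟩
        intro D hD hSD hne
        have hfD := f.map_code hD
        have hDU := hall _ ⟨D, ⟨hD, hSD⟩, rfl⟩
        have hne' : E ≠ f D := fun h => hne (by rw [h, f.symm_apply_apply hD])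
        have h1 := finrank_inf_lt_of_ne (hE.1.trans hfD.1.symm) hne'
        have h2 := finrank_sup_add_finrank_inf_eq E (f D)
        have h3 := finrank_mono (sup_le hEU hDU)
        have h4 := f.symm.map_adj hE hfD (by rw [hE.1] at h1 h2; rw [hfD.1] at h2; omega)
        rwa [f.symm_apply_apply hD] at h4
      · rintro ⟨C, hC, rfl⟩
        exact ⟨f.map_code hC.1, hall _ ⟨C, hC, rfl⟩⟩
    have h1 := ncard_top_lt (by omega) hU
    have h2 := le_ncard_top hU fun i =>
      let ⟨x, hx, hxi⟩ := (f.map_code hA.1).2 i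
      ⟨x, hall _ ⟨A, hA, rfl⟩ hx, hxi⟩
    rw [htop, hcard] at h1 h2
    -- A star of size `[n - k]` would be smaller than `[k + 2]`, forcing `n ≤ 2k + 1`; but at most
    -- `n` hyperplanes are lost, so `q ^ (k + 1) ≤ n`, against `2k + 1 < 2 ^ (k + 1)`.
    rcases le_total (k + 1 + 1) (n - k) with hle | hle
    · have := pointCount_mono (Nat.card F) hle
      omega
    · rcases hle.eq_or_lt with he | hlt
      · rw [he] at h1
        omega
      · have h3 := pointCount_mono (Nat.card F) (show n - k ≤ k + 1 by omega)
        rw [pointCount_succ] at h2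
        have h4 : 2 ^ (k + 1) ≤ Nat.card F ^ (k + 1) := Nat.pow_le_pow_left hq _
        have h5 : 2 * k + 1 < 2 ^ (k + 1) := by
          clear * - hk
          induction k, hk using Nat.le_induction with
          | base => norm_num
          | succ m _ ih => rw [pow_succ]; omega
        omega

/-- Going forth with `f` and back with `f.symm` returns a star containing the one of `S`, so its
centre is `S` again; this gives the converse inclusion. -/
theorem CodeAut.exists_star_iff (f : CodeAut F n (k + 1)) (hk : 1 ≤ k) (hkn : k + 2 < n)
    {S : Submodule F (Fin n → F)} (hS : IsCode k S) :
    ∃ S', IsCode k S' ∧ ∀ C, IsCode (k + 1) C → (S ≤ C ↔ S' ≤ f C) := by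
  obtain ⟨S', hS', h⟩ := f.exists_star_image hk hkn hS
  obtain ⟨T, hT, h'⟩ := f.symm.exists_star_image hk hkn hS'
  obtain rfl : T = S := eq_of_le_star hkn.le hS hT fun C hC hSC => by
    have := h' _ (f.map_code hC) (h C hC hSC)
    rwa [f.symm_apply_apply hC] at this
  refine ⟨S', hS', fun C hC => ⟨h C hC, fun hle => ?_⟩⟩
  have := h' _ (f.map_code hC) hle
  rwa [f.symm_apply_apply hC] at this

theorem exists_star_map (hk : 1 ≤ k) (hkn : k + 2 < n) (f : CodeAut F n (k + 1)) :
    ∃ g : Submodule F (Fin n → F) → Submodule F (Fin n → F), ∀ S, IsCode k S →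
      IsCode k (g S) ∧ ∀ C, IsCode (k + 1) C → (S ≤ C ↔ g S ≤ f C) := by
  classical
  refine ⟨fun S => if h : IsCode k S then (f.exists_star_iff hk hkn h).choose else S,
    fun S hS => ?_⟩
  simp only [dif_pos hS]
  exact (f.exists_star_iff hk hkn hS).choose_spec

/-- The automorphism of the graph of `k`-dimensional codes induced by an automorphism of the graph
of `(k + 1)`-dimensional codes. -/
theorem CodeAut.exists_lower (hk : 1 ≤ k) (hkn : k + 2 < n) (f : CodeAut F n (k + 1)) :
    ∃ g : CodeAut F n k, ∀ S, IsCode k S → ∀ C, IsCode (k + 1) C → (S ≤ C ↔ g S ≤ f C) := by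
  obtain ⟨g, hg⟩ := exists_star_map hk hkn f
  obtain ⟨h, hh⟩ := exists_star_map hk hkn f.symm
  have hhg : ∀ S, IsCode k S → h (g S) = S := fun S hS =>
    eq_of_le_star hkn.le hS (hh _ (hg S hS).1).1 fun C hC hSC => by
      have := ((hh _ (hg S hS).1).2 _ (f.map_code hC)).1 (((hg S hS).2 C hC).1 hSC)
      rwa [f.symm_apply_apply hC] at this
  have hgh : ∀ S, IsCode k S → g (h S) = S := fun S hS =>
    eq_of_le_star hkn.le hS (hg _ (hh S hS).1).1 fun C hC hSC => by
      have := ((hg _ (hh S hS).1).2 _ (f.symm.map_code hC)).1 (((hh S hS).2 C hC).1 hSC)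
      rwa [f.apply_symm_apply hC] at this
  refine ⟨⟨g, h, fun hC => (hg _ hC).1, fun hC => (hh _ hC).1, fun hC => hhg _ hC,
    fun hC => hgh _ hC, ?_, ?_⟩, fun S hS C hC => (hg S hS).2 C hC⟩
  · intro S T hS hT hadj
    rw [adj_iff_exists_code hS hT] at hadj
    obtain ⟨hne, C, hC, hSC, hTC⟩ := hadj
    refine (adj_iff_exists_code (hg S hS).1 (hg T hT).1).2
      ⟨fun he => hne (by rw [← hhg S hS, he, hhg T hT]), f C, f.map_code hC,
        ((hg S hS).2 C hC).1 hSC, ((hg T hT).2 C hC).1 hTC⟩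
  · intro S T hS hT hadj
    rw [adj_iff_exists_code hS hT] at hadj
    obtain ⟨hne, C, hC, hSC, hTC⟩ := hadj
    refine (adj_iff_exists_code (hh S hS).1 (hh T hT).1).2
      ⟨fun he => hne (by rw [← hgh S hS, he, hgh T hT]), f.symm C, f.inv_code hC,
        ((hh S hS).2 C hC).1 hSC, ((hh T hT).2 C hC).1 hTC⟩

end Codes

/-! ### Monomial semilinear maps and their action on codes -/

section Monomial

variable {F : Type*} [Field F] {n k : ℕ}

/-- The data of a monomial semilinear automorphism `v ↦ (j ↦ a j * σ (v (δ⁻¹ j)))`. -/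
structure MonomialData (F : Type*) [Field F] (n : ℕ) where
  σ : F ≃+* F
  δ : Equiv.Perm (Fin n)
  a : Fin n → Fˣ

namespace MonomialData

/-- The map given by monomial data. -/
def app (m : MonomialData F n) (v : Fin n → F) : Fin n → F :=
  fun j => m.a j * m.σ (v (m.δ.symm j))

/-- The inverse of monomial data. -/
def inv (m : MonomialData F n) : MonomialData F n where
  σ := m.σ.symm
  δ := m.δ.symm
  a i := (Units.map (m.σ.symm : F →* F) (m.a (m.δ i)))⁻¹

/-- The composition of monomial data. -/
def comp (m₁ m₂ : MonomialData F n) : MonomialData F n where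
  σ := m₂.σ.trans m₁.σ
  δ := m₂.δ.trans m₁.δ
  a j := m₁.a j * Units.map (m₁.σ : F →* F) (m₂.a (m₁.δ.symm j))

@[simp] theorem app_comp (m₁ m₂ : MonomialData F n) (v : Fin n → F) :
    (m₁.comp m₂).app v = m₁.app (m₂.app v) := by
  ext j
  simp [app, comp, mul_assoc]

@[simp] theorem app_inv_app (m : MonomialData F n) (v : Fin n → F) : m.app (m.inv.app v) = v := by
  ext j
  simp [app, inv]

@[simp] theorem inv_app_app (m : MonomialData F n) (v : Fin n → F) : m.inv.app (m.app v) = v := by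
  ext j
  simp [app, inv]

/-- The semilinear automorphism given by monomial data. -/
def equiv (m : MonomialData F n) : (Fin n → F) ≃ₛₗ[(m.σ : F →+* F)] (Fin n → F) where
  toFun := m.app
  invFun := m.inv.app
  left_inv := m.inv_app_app
  right_inv := m.app_inv_app
  map_add' v w := by ext j; simp [app, mul_add]
  map_smul' c v := by ext j; simp [app]; ring

theorem app_add (m : MonomialData F n) (v w : Fin n → F) : m.app (v + w) = m.app v + m.app w :=
  m.equiv.map_add v w

theorem app_smul (m : MonomialData F n) (c : F) (v : Fin n → F) :
    m.app (c • v) = m.σ c • m.app v :=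
  m.equiv.map_smulₛₗ c v

theorem isMonomial_equiv (m : MonomialData F n) : IsMonomial m.equiv := by
  refine ⟨m.δ, fun i => m.a (m.δ i), fun i => (m.a _).ne_zero, fun i => ?_⟩
  ext j
  change (m.a j : F) * m.σ ((Pi.single i 1 : Fin n → F) (m.δ.symm j)) = _
  by_cases h : j = m.δ i
  · subst h
    simp
  · have h' : m.δ.symm j ≠ i := fun he => h (by rw [← he]; simp)
    simp [h, h']

theorem exists_of_isMonomial {σ : F ≃+* F} {l : (Fin n → F) ≃ₛₗ[(σ : F →+* F)] (Fin n → F)}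
    (hl : IsMonomial l) : ∃ m : MonomialData F n, ∀ v, l v = m.app v := by
  obtain ⟨δ, a, ha, h⟩ := hl
  refine ⟨⟨σ, δ, fun j => Units.mk0 (a (δ.symm j)) (ha _)⟩, fun v => ?_⟩
  have hv : v = ∑ i, v i • (Pi.single i 1 : Fin n → F) := by
    ext j
    simp [Finset.sum_apply, Pi.single_apply]
  conv_lhs => rw [hv]
  rw [map_sum]
  simp_rw [LinearEquiv.map_smulₛₗ, h]
  ext j
  simp only [Finset.sum_apply, Pi.smul_apply, smul_eq_mul, app, Units.val_mk0]
  rw [Finset.sum_eq_single (δ.symm j)]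
  · simp [mul_comm]
  · intro i _ hi
    have : j ≠ δ i := fun he => hi (by rw [he]; simp)
    simp [this]
  · simp

/-- The action of monomial data on subspaces. -/
def act (m : MonomialData F n) (C : Submodule F (Fin n → F)) : Submodule F (Fin n → F) :=
  C.map (m.equiv : (Fin n → F) →ₛₗ[(m.σ : F →+* F)] (Fin n → F))

theorem mem_act {m : MonomialData F n} {C : Submodule F (Fin n → F)} {y : Fin n → F} :
    y ∈ m.act C ↔ m.inv.app y ∈ C := by
  constructor
  · rintro ⟨x, hx, rfl⟩
    change m.inv.app (m.app x) ∈ C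
    rwa [inv_app_app]
  · intro h
    exact ⟨_, h, m.app_inv_app y⟩

@[simp] theorem app_mem_act {m : MonomialData F n} {C : Submodule F (Fin n → F)} {y : Fin n → F} :
    m.app y ∈ m.act C ↔ y ∈ C := by
  rw [mem_act, inv_app_app]

theorem act_comp (m₁ m₂ : MonomialData F n) (C : Submodule F (Fin n → F)) :
    (m₁.comp m₂).act C = m₁.act (m₂.act C) := by
  ext y
  obtain ⟨x, rfl⟩ : ∃ x, (m₁.comp m₂).app x = y := ⟨_, app_inv_app _ _⟩
  rw [app_mem_act, app_comp, app_mem_act, app_mem_act]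

@[simp] theorem act_inv_act (m : MonomialData F n) (C : Submodule F (Fin n → F)) :
    m.act (m.inv.act C) = C := by
  ext y
  rw [mem_act, app_mem_act]

@[simp] theorem inv_act_act (m : MonomialData F n) (C : Submodule F (Fin n → F)) :
    m.inv.act (m.act C) = C := by
  ext y
  rw [← app_mem_act (m := m), act_inv_act, app_mem_act]

theorem act_inf (m : MonomialData F n) (C D : Submodule F (Fin n → F)) :
    m.act (C ⊓ D) = m.act C ⊓ m.act D := by
  ext y
  simp only [mem_act, mem_inf]

theorem act_mono (m : MonomialData F n) {C D : Submodule F (Fin n → F)} (h : C ≤ D) :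
    m.act C ≤ m.act D :=
  Submodule.map_mono h

theorem act_span (m : MonomialData F n) (s : Set (Fin n → F)) :
    m.act (span F s) = span F (m.app '' s) :=
  Submodule.map_span _ _

/-- The map is only semilinear, so the dimension is recovered from the cardinality `q ^ dim`. -/
theorem finrank_act [Finite F] (m : MonomialData F n) (C : Submodule F (Fin n → F)) :
    finrank F (m.act C) = finrank F C := by
  have hq : 1 < Nat.card F := Finite.one_lt_card
  refine Nat.pow_right_injective hq ?_
  change Nat.card F ^ _ = Nat.card F ^ _
  rw [← ncard_eq_pow_finrank, ← ncard_eq_pow_finrank]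
  exact Set.ncard_image_of_injective _ m.equiv.injective

theorem isCode_act [Finite F] (m : MonomialData F n) {C : Submodule F (Fin n → F)}
    (hC : IsCode k C) : IsCode k (m.act C) := by
  refine ⟨by rw [finrank_act, hC.1], fun i => ?_⟩
  obtain ⟨x, hx, hxi⟩ := hC.2 (m.δ.symm i)
  exact ⟨m.app x, app_mem_act.2 hx, by simpa [app] using hxi⟩

end MonomialData

/-- The automorphism of the graph of codes induced by monomial data. -/
def CodeAut.ofMonomial [Finite F] (k : ℕ) (m : MonomialData F n) : CodeAut F n k where
  toFun := m.act
  invFun := m.inv.act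
  map_code := m.isCode_act
  inv_code := m.inv.isCode_act
  left_inv _ := m.inv_act_act _
  right_inv _ := m.act_inv_act _
  map_adj _ _ h := by rwa [← m.act_inf, m.finrank_act]
  inv_adj _ _ h := by rwa [← m.inv.act_inf, m.inv.finrank_act]

@[simp] theorem CodeAut.ofMonomial_apply [Finite F] (m : MonomialData F n)
    (C : Submodule F (Fin n → F)) : CodeAut.ofMonomial k m C = m.act C := rfl

/-- The automorphism `f` is induced by a monomial semilinear automorphism. -/
def CodeAut.IsMonomialAut (f : CodeAut F n k) : Prop :=
  ∃ m : MonomialData F n, ∀ C, IsCode k C → f C = m.act C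

/-- Allows `f` to be normalized by monomial maps without affecting the conclusion. -/
theorem CodeAut.IsMonomialAut.of_inv_comp [Finite F] {f : CodeAut F n k} {m : MonomialData F n}
    (h : ((CodeAut.ofMonomial k m.inv).comp f).IsMonomialAut) : f.IsMonomialAut := by
  obtain ⟨m', hm'⟩ := h
  refine ⟨m.comp m', fun C hC => ?_⟩
  rw [m.act_comp, ← hm' C hC, comp_apply, ofMonomial_apply, m.act_inv_act]

theorem CodeAut.IsMonomialAut.of_eq_self {f : CodeAut F n k} (h : ∀ C, IsCode k C → f C = C) :
    f.IsMonomialAut := by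
  refine ⟨⟨RingEquiv.refl F, 1, 1⟩, fun C hC => ?_⟩
  rw [h C hC]
  ext y
  rw [MonomialData.mem_act]
  have : (MonomialData.inv ⟨RingEquiv.refl F, 1, 1⟩ : MonomialData F n).app y = y := by
    ext j
    simp [MonomialData.app, MonomialData.inv]
  rw [this]

end Monomial

/-! ### The induction step -/

section Lowering

variable {F : Type*} [Field F] {n k : ℕ}

theorem eq_of_code_le {C D : Submodule F (Fin n → F)} (hC : IsCode k C) (hD : IsCode k D)
    (h : C ≤ D) : C = D :=
  eq_of_le_of_finrank_eq h (hC.1.trans hD.1.symm)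

/-- If every `k`-dimensional code in a code stays in its image, then all codes containing a vector
with at most one zero coordinate are fixed. -/
theorem apply_eq_self_of_mem (f : CodeAut F n (k + 1)) (hk : 2 ≤ k)
    (hfix : ∀ S, IsCode k S → ∀ C, IsCode (k + 1) C → S ≤ C → S ≤ f C)
    {C : Submodule F (Fin n → F)} (hC : IsCode (k + 1) C) {x : Fin n → F} {j : Fin n} (hx : x ∈ C)
    (hxj : ∀ i, i ≠ j → x i ≠ 0) : f C = C := by
  -- Since `k ≥ 2`, some `k`-dimensional `S ≤ C` contains both `x` and `y`. It is non-degenerate,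
  -- with `y` taking care of coordinate `j` and `x` of the others, so `S ≤ f C`.
  have key : ∀ y ∈ C, y j ≠ 0 → y ∈ f C := by
    intro y hy hyj
    have hle : span F {x, y} ≤ C := by
      rw [span_le]
      rintro z (rfl | rfl)
      exacts [hx, hy]
    have h2 : finrank F (span F {x, y}) ≤ 2 := by
      classical
      have := finrank_span_finset_le_card (R := F) ({x, y} : Finset (Fin n → F))
      rw [Finset.coe_pair] at this
      exact this.trans Finset.card_le_two
    obtain ⟨S, hS1, hS2, hS⟩ := exists_between_finrank hle (h2.trans hk) (by rw [hC.1]; omega)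
    have hxS : x ∈ S := hS1 (subset_span (by simp))
    have hyS : y ∈ S := hS1 (subset_span (by simp))
    refine hfix S ⟨hS, fun i => ?_⟩ C hC hS2 hyS
    by_cases hij : i = j
    · exact ⟨y, hyS, hij ▸ hyj⟩
    · exact ⟨x, hxS, hxj i hij⟩
  refine (eq_of_code_le hC (f.map_code hC) fun y hy => ?_).symm
  by_cases hyj : y j = 0
  · obtain ⟨c, hc, hcj⟩ := hC.2 j
    have h1 := key (y + c) (add_mem hy hc) (by simpa [hyj] using hcj)
    simpa using sub_mem h1 (key c hc hcj)
  · exact key y hy hyj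

/-- For a hyperplane `D` of `C` on which coordinate `j` does not vanish, `D + x` is a fixed code
adjacent to `C`, so `f C` meets it in dimension `k`. If `f C` left `C + x`, all these intersections
would equal `f C ⊓ (C + x)`; but the spaces `D + x` have only `⟨x⟩` in common, which is too small.
-/
theorem apply_le_sup_of_notMem (f : CodeAut F n (k + 1)) (hk : 2 ≤ k)
    (hfix : ∀ S, IsCode k S → ∀ C, IsCode (k + 1) C → S ≤ C → S ≤ f C)
    {C : Submodule F (Fin n → F)} (hC : IsCode (k + 1) C) {x : Fin n → F} {j : Fin n} (hx : x ∉ C)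
    (hxj : ∀ i, i ≠ j → x i ≠ 0) : f C ≤ C ⊔ span F {x} := by
  by_contra hE
  have hfC := f.map_code hC
  set G := f C ⊓ (C ⊔ span F {x})
  have hG : finrank F G ≤ k := by
    have : finrank F G < finrank F (f C) :=
      finrank_lt_finrank_of_lt (lt_of_le_of_ne inf_le_left fun he => hE (inf_eq_left.1 he))
    rw [hfC.1] at this
    omega
  have key : ∀ D ≤ C, finrank F D = k → (∃ b ∈ D, b j ≠ 0) →
      finrank F G = k ∧ G ≤ D ⊔ span F {x} := by
    rintro D hDC hD ⟨b, hb, hbj⟩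
    have hxD : x ∉ D := fun h => hx (hDC h)
    have hcode : IsCode (k + 1) (D ⊔ span F {x}) := by
      refine ⟨by rw [finrank_sup_span_of_notMem hxD, hD], fun i => ?_⟩
      by_cases hij : i = j
      · exact ⟨b, mem_sup_left hb, hij ▸ hbj⟩
      · exact ⟨x, mem_sup_span_self _ _, hxj i hij⟩
    have hne : C ≠ D ⊔ span F {x} := fun h => hx (h ▸ mem_sup_span_self _ _)
    have hinf := inf_eq_of_star (S := D) (by rw [hC.1, hD]) (by rw [hcode.1, hD]) hDC le_sup_left hne
    have hadj := f.map_adj hC hcode (by rw [hinf, hD])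
    rw [apply_eq_self_of_mem f hk hfix hcode (mem_sup_span_self _ _) hxj] at hadj
    have hle : f C ⊓ (D ⊔ span F {x}) ≤ G := inf_le_inf_left _ (sup_le_sup_right hDC _)
    have heq := eq_of_le_of_finrank_le hle (by omega)
    exact ⟨by rw [← heq]; omega, heq ▸ inf_le_right⟩
  have hGx : G ≤ span F {x} := by
    intro g hg
    obtain ⟨c, hc, a, rfl⟩ := mem_sup_span.1 hg.2
    by_cases hc0 : c = 0
    · rw [hc0, zero_add]
      exact smul_mem _ _ (mem_span_singleton_self x)
    exfalso
    -- A hyperplane of `C` through `b` and missing `c` is admissible as `D`, and `c + a • x` is not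
    -- in `D + x`.
    obtain ⟨b, hb, hbj, hcb⟩ : ∃ b ∈ C, b j ≠ 0 ∧ c ∉ span F {b} := by
      by_cases hcj : c j = 0
      · obtain ⟨b, hb, hbj⟩ := hC.2 j
        refine ⟨b, hb, hbj, fun h => hc0 ?_⟩
        obtain ⟨t, rfl⟩ := mem_span_singleton.1 h
        have : t = 0 := by simpa [hbj] using hcj
        simp [this]
      · have h1 := finrank_inf_coordHyperplane hc hcj
        obtain ⟨w, hw, hw0⟩ := exists_mem_ne_zero_of_ne_bot
          (p := C ⊓ coordHyperplane F j) (fun h => by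
            rw [h, finrank_bot, hC.1] at h1
            omega)
        have hwj : w j = 0 := hw.2
        refine ⟨c + w, add_mem hc hw.1, by simpa [hwj] using hcj, fun h => hw0 ?_⟩
        obtain ⟨t, ht⟩ := mem_span_singleton.1 h
        have h2 := congrFun ht j
        have : t = 1 := by simpa [hwj, hcj] using h2
        simpa [this] using ht
    obtain ⟨D, hbD, hDC, hcD, hD⟩ := exists_hyperplane
      ((span_singleton_le_iff_mem _ _).2 hb) hc hcb
    have h1 := (key D hDC (by rw [hC.1] at hD; omega)
      ⟨b, hbD (mem_span_singleton_self b), hbj⟩).2 hg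
    obtain ⟨d, hd, a', h2⟩ := mem_sup_span.1 h1
    have h3 : (a' - a) • x ∈ C := by
      have : (a' - a) • x = c - d := by rw [sub_smul]; linear_combination h2
      rw [this]
      exact sub_mem hc (hDC hd)
    by_cases ha : a' - a = 0
    · rw [sub_eq_zero.1 ha] at h2
      exact hcD (add_right_cancel h2 ▸ hd)
    · exact hx ((smul_mem_iff _ ha).1 h3)
  obtain ⟨b, hb, hbj⟩ := hC.2 j
  obtain ⟨D, hbD, hDC, hD⟩ := exists_between_finrank ((span_singleton_le_iff_mem _ _).2 hb) (m := k)
    (by rw [finrank_span_singleton (fun h => hbj (by simp [h]))]; omega) (by rw [hC.1]; omega)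
  have h1 := (key D hDC hD ⟨b, hbD (mem_span_singleton_self b), hbj⟩).1
  have h2 := (finrank_mono hGx).trans (finrank_span_le_card (R := F) ({x} : Set (Fin n → F)))
  simp at h2
  omega

theorem exists_single_notMem (hkn : k < n) {T : Submodule F (Fin n → F)} (hT : finrank F T ≤ k) :
    ∃ j, (Pi.single j 1 : Fin n → F) ∉ T := by
  by_contra! h
  have : T = ⊤ := by
    rw [eq_top_iff, ← (Pi.basisFun F (Fin n)).span_eq, span_le]
    rintro _ ⟨i, rfl⟩
    simpa using h i
  rw [this, finrank_top, finrank_fin_fun] at hT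
  omega

/-- The image of `C` lies in `C + 1` and in `C + (1 - e_j)`. As `C + 1` has dimension `k + 2 < n`,
`j` can be chosen with `e_j` outside it, and then the two spaces meet in `C`. -/
theorem apply_eq_self_of_lower (f : CodeAut F n (k + 1)) (hk : 2 ≤ k) (hkn : k + 2 < n)
    (hfix : ∀ S, IsCode k S → ∀ C, IsCode (k + 1) C → S ≤ C → S ≤ f C)
    {C : Submodule F (Fin n → F)} (hC : IsCode (k + 1) C) : f C = C := by
  let x : Fin n → F := 1
  by_cases hx : x ∈ C
  · exact apply_eq_self_of_mem f hk hfix hC (j := ⟨0, by omega⟩) hx fun i _ => one_ne_zero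
  obtain ⟨j, hj⟩ := exists_single_notMem (T := C ⊔ span F {x}) (k := k + 2) hkn
    (by rw [finrank_sup_span_of_notMem hx, hC.1])
  set e : Fin n → F := Pi.single j 1
  have hye : ∀ i, i ≠ j → (x - e) i ≠ 0 := by
    intro i hi
    simp [x, e, hi]
  by_cases hy : x - e ∈ C
  · exact apply_eq_self_of_mem f hk hfix hC hy hye
  refine eq_of_code_le (f.map_code hC) hC fun z hz => ?_
  obtain ⟨c, hc, a, h1⟩ := mem_sup_span.1 (apply_le_sup_of_notMem f hk hfix hC hy hye hz)
  obtain ⟨d, hd, b, h2⟩ := mem_sup_span.1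
    (apply_le_sup_of_notMem f hk hfix hC (j := j) hx (fun i _ => one_ne_zero) hz)
  by_cases ha : a = 0
  · rwa [← h1, ha, zero_smul, add_zero]
  · refine absurd ((smul_mem_iff _ ha).1 ?_) hj
    refine mem_sup_span.2 ⟨c - d, sub_mem hc hd, a - b, ?_⟩
    rw [smul_sub] at h1
    rw [sub_smul]
    linear_combination h1 - h2

/-- The induction step: if the automorphism induced on the graph of `k`-dimensional codes is
monomial, then so is the automorphism of the graph of `(k + 1)`-dimensional codes. -/
theorem CodeAut.IsMonomialAut.of_lower [Finite F] {f : CodeAut F n (k + 1)} (hk : 2 ≤ k)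
    (hkn : k + 2 < n) {g : CodeAut F n k} (hg : g.IsMonomialAut)
    (hgf : ∀ S, IsCode k S → ∀ C, IsCode (k + 1) C → (S ≤ C ↔ g S ≤ f C)) : f.IsMonomialAut := by
  obtain ⟨m, hm⟩ := hg
  refine IsMonomialAut.of_inv_comp (m := m) (IsMonomialAut.of_eq_self fun C hC =>
    apply_eq_self_of_lower _ hk hkn (fun S hS C hC hSC => ?_) hC)
  have h := m.inv.act_mono ((hgf S hS C hC).1 hSC)
  rwa [hm S hS, m.inv_act_act] at h

end Lowering

/-! ### Planes: nowhere zero points and points with one zero coordinate -/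

section Points

variable {F : Type*} [Field F] {n : ℕ}

/-- The standard basis vectors. -/
abbrev unitVec (F : Type*) [Field F] {n : ℕ} (i : Fin n) : Fin n → F := Pi.single i 1

/-- All coordinates of `x` are non-zero. -/
def NowhereZero (x : Fin n → F) : Prop := ∀ i, x i ≠ 0

/-- The only zero coordinate of `p` is the `i`-th one. -/
def OnlyZeroAt (i : Fin n) (p : Fin n → F) : Prop := p i = 0 ∧ ∀ j, j ≠ i → p j ≠ 0

theorem NowhereZero.ne_zero (hn : 0 < n) {x : Fin n → F} (hx : NowhereZero x) : x ≠ 0 :=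
  fun h => hx ⟨0, hn⟩ (by simp [h])

theorem unitVec_ne_zero (i : Fin n) : unitVec F i ≠ 0 := by
  simp [unitVec]

theorem unitVec_apply_of_ne {i j : Fin n} (h : j ≠ i) : unitVec F i j = 0 := by
  simp [unitVec, h]

theorem exists_ne_of_lt (s : Finset (Fin n)) (h : s.card < n) : ∃ i, i ∉ s := by
  by_contra! hall
  have : s = Finset.univ := Finset.eq_univ_iff_forall.2 hall
  rw [this, Finset.card_univ, Fintype.card_fin] at h
  omega

theorem exists_ne_one (hn : 2 ≤ n) (i : Fin n) : ∃ j, j ≠ i := by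
  obtain ⟨j, hj⟩ := exists_ne_of_lt {i} (by simp; omega)
  exact ⟨j, by simpa using hj⟩

theorem exists_ne_two (hn : 3 ≤ n) (i j : Fin n) : ∃ h, h ≠ i ∧ h ≠ j := by
  obtain ⟨h, hh⟩ := exists_ne_of_lt {i, j} (Finset.card_le_two.trans_lt (by omega))
  exact ⟨h, by simpa using hh⟩

theorem exists_ne_three (hn : 4 ≤ n) (i j k : Fin n) : ∃ h, h ≠ i ∧ h ≠ j ∧ h ≠ k := by
  obtain ⟨h, hh⟩ := exists_ne_of_lt {i, j, k} (Finset.card_le_three.trans_lt (by omega))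
  exact ⟨h, by simpa using hh⟩

theorem notMem_span_singleton {x v : Fin n → F} {i : Fin n} (hv : v i = 0) (hx : x i ≠ 0)
    (hv0 : v ≠ 0) : v ∉ span F {x} := by
  intro h
  obtain ⟨a, rfl⟩ := mem_span_singleton.1 h
  have : a = 0 := by simpa [hx] using hv
  simp [this] at hv0

theorem unitVec_notMem_span (hn : 2 ≤ n) {x : Fin n → F} (hx : NowhereZero x) (i : Fin n) :
    unitVec F i ∉ span F {x} := by
  obtain ⟨j, hj⟩ := exists_ne_one hn i
  exact notMem_span_singleton (unitVec_apply_of_ne hj) (hx j) (unitVec_ne_zero i)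

theorem mem_comb_of_finrank_two {C : Submodule F (Fin n → F)} (hC : finrank F C = 2)
    {x v y : Fin n → F} (hx0 : x ≠ 0) (hx : x ∈ C) (hv : v ∈ C) (hvx : v ∉ span F {x})
    (hy : y ∈ C) : ∃ a b : F, a • x + b • v = y := by
  rw [eq_span_pair hC hx0 hx hv hvx] at hy
  exact mem_span_pair.1 hy

theorem isCode_one_span {x : Fin n → F} (hn : 0 < n) (hx : NowhereZero x) :
    IsCode 1 (span F {x}) :=
  ⟨finrank_span_singleton (hx.ne_zero hn), fun i => ⟨x, mem_span_singleton_self x, hx i⟩⟩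

theorem IsCode.exists_eq_span {L : Submodule F (Fin n → F)} (hL : IsCode 1 L) :
    ∃ x, NowhereZero x ∧ L = span F {x} := by
  obtain ⟨⟨x, hx⟩, hx0, hall⟩ := finrank_eq_one_iff'.1 hL.1
  have hspan : L = span F {x} := by
    refine le_antisymm (fun y hy => ?_) ((span_singleton_le_iff_mem _ _).2 hx)
    obtain ⟨c, hc⟩ := hall ⟨y, hy⟩
    exact mem_span_singleton.2 ⟨c, congrArg Subtype.val hc⟩
  refine ⟨x, fun i hi => ?_, hspan⟩
  obtain ⟨y, hy, hyi⟩ := hL.2 i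
  rw [hspan] at hy
  obtain ⟨c, rfl⟩ := mem_span_singleton.1 hy
  simp [hi] at hyi

theorem isCode_span_pair (hn : 0 < n) {x v : Fin n → F} (hx : NowhereZero x)
    (hv : v ∉ span F {x}) : IsCode 2 (span F {x, v}) :=
  ⟨finrank_span_pair (hx.ne_zero hn) hv, fun i => ⟨x, subset_span (by simp), hx i⟩⟩

/-- Induction on nowhere zero vectors by changing one coordinate at a time. -/
theorem nowhereZero_induction {P : (Fin n → F) → Prop} (h1 : P 1)
    (hstep : ∀ x, NowhereZero x → ∀ (i : Fin n) (c : F), c ≠ 0 → P x → P (Function.update x i c))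
    {y : Fin n → F} (hy : NowhereZero y) : P y := by
  classical
  have key : ∀ s : Finset (Fin n), P (s.piecewise y 1) := by
    intro s
    induction s using Finset.induction_on with
    | empty => simpa using h1
    | insert j s _ ih =>
      rw [Finset.piecewise_insert]
      refine hstep _ (fun i => ?_) j _ (hy j) ih
      by_cases hi : i ∈ s
      · simpa [hi] using hy i
      · simp [hi]
  simpa using key Finset.univ

theorem update_eq_add (x : Fin n → F) (i : Fin n) (c : F) :
    Function.update x i c = x + (c - x i) • unitVec F i := by
  ext j
  by_cases h : j = i
  · subst h; simp
  · simp [h]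

/-- The plane spanned by two distinct basis vectors vanishes on a third coordinate. -/
theorem unitVec_unique (hn : 3 ≤ n) {C : Submodule F (Fin n → F)} (hC : IsCode 2 C) {i j : Fin n}
    (hi : unitVec F i ∈ C) (hj : unitVec F j ∈ C) : i = j := by
  by_contra hij
  obtain ⟨h, hhi, hhj⟩ := exists_ne_two hn i j
  obtain ⟨x, hx, hxh⟩ := hC.2 h
  obtain ⟨a, b, rfl⟩ := mem_comb_of_finrank_two hC.1 (unitVec_ne_zero i) hi hj
    (notMem_span_singleton (i := i) (unitVec_apply_of_ne hij) (by simp) (unitVec_ne_zero j)) hx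
  simp [hhi, hhj] at hxh

/-- Clearing coordinate `i` of any vector of `C` off `⟨e_i⟩` works: another zero coordinate would
vanish on all of `C`. -/
theorem IsCode.exists_onlyZeroAt {C : Submodule F (Fin n → F)} (hC : IsCode 2 C)
    {i : Fin n} (hi : unitVec F i ∈ C) : ∃ p ∈ C, OnlyZeroAt i p := by
  obtain ⟨w, hw, hwi⟩ := exists_mem_notMem_of_finrank_lt (S := span F {unitVec F i}) (T := C)
    (by rw [finrank_span_singleton (unitVec_ne_zero i), hC.1]; omega)
  refine ⟨w - w i • unitVec F i, sub_mem hw (smul_mem _ _ hi), by simp, fun j hj hwj => ?_⟩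
  have hwj' : w j = 0 := by simpa [hj] using hwj
  obtain ⟨x, hx, hxj⟩ := hC.2 j
  obtain ⟨a, b, rfl⟩ := mem_comb_of_finrank_two hC.1 (unitVec_ne_zero i) hi hw hwi hx
  simp [hj, hwj'] at hxj

theorem OnlyZeroAt.nowhereZero_add {i : Fin n} {p : Fin n → F} (hp : OnlyZeroAt i p) :
    NowhereZero (p + unitVec F i) := by
  intro j
  by_cases h : j = i
  · subst h; simp [hp.1]
  · simpa [h] using hp.2 j h

theorem OnlyZeroAt.ne_zero (hn : 2 ≤ n) {i : Fin n} {p : Fin n → F} (hp : OnlyZeroAt i p) :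
    p ≠ 0 := by
  obtain ⟨j, hj⟩ := exists_ne_one hn i
  exact fun h => hp.2 j hj (by simp [h])

theorem OnlyZeroAt.unitVec_notMem (hn : 2 ≤ n) {i : Fin n} {p : Fin n → F} (hp : OnlyZeroAt i p) :
    unitVec F i ∉ span F {p} := by
  obtain ⟨j, hj⟩ := exists_ne_one hn i
  exact notMem_span_singleton (unitVec_apply_of_ne hj) (hp.2 j hj) (unitVec_ne_zero i)

theorem not_isCode_of_le {C : Submodule F (Fin n → F)} {k : ℕ} {i : Fin n}
    (h : C ≤ coordHyperplane F i) : ¬ IsCode k C := fun hC => hC.not_le i h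

variable [Finite F]

/-- The lowered automorphism acts on nowhere zero points; `φ` picks representative vectors, with
arbitrary scaling. -/
theorem exists_point_map (hn : 4 ≤ n) (f : CodeAut F n 2) :
    ∃ φ : (Fin n → F) → (Fin n → F), ∀ x, NowhereZero x →
      NowhereZero (φ x) ∧ ∀ C, IsCode 2 C → (x ∈ C ↔ φ x ∈ f C) := by
  obtain ⟨g, hg⟩ := f.exists_lower le_rfl (by omega)
  have : ∀ x : Fin n → F, ∃ y, NowhereZero x →
      NowhereZero y ∧ ∀ C, IsCode 2 C → (x ∈ C ↔ y ∈ f C) := by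
    intro x
    by_cases hx : NowhereZero x
    · have hc := isCode_one_span (by omega) hx
      obtain ⟨y, hy, hgy⟩ := (g.map_code hc).exists_eq_span
      refine ⟨y, fun _ => ⟨hy, fun C hC => ?_⟩⟩
      have := hg _ hc C hC
      rwa [hgy, span_singleton_le_iff_mem, span_singleton_le_iff_mem] at this
    · exact ⟨0, fun h => absurd h hx⟩
  choose φ hφ using this
  exact ⟨φ, hφ⟩

/-- The number of planes through `p` which are not contained in a given coordinate hyperplane
through `p`. -/
theorem ncard_planes_through {p : Fin n → F} {i : Fin n} (hn : 2 ≤ n) (hp : p ≠ 0)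
    (hpi : p i = 0) :
    {C : Submodule F (Fin n → F) | finrank F C = 2 ∧ p ∈ C ∧ ¬ C ≤ coordHyperplane F i}.ncard =
      Nat.card F ^ (n - 2) := by
  have hd : finrank F (span F {p}) = 1 := finrank_span_singleton hp
  have h1 := ncard_interval (S := span F {p}) (U := ⊤) le_top
  have h2 := ncard_interval (S := span F {p}) (U := coordHyperplane F i)
    ((span_singleton_le_iff_mem _ _).2 hpi)
  have h3 := finrank_coordHyperplane (F := F) i
  rw [finrank_top, finrank_fin_fun, hd] at h1
  rw [hd, show finrank F (coordHyperplane F i) - 1 = n - 2 by omega] at h2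
  rw [show n - 1 = n - 2 + 1 by omega, pointCount_succ] at h1
  have h4 := Set.ncard_sdiff_add_ncard_of_subset (s := {C : Submodule F (Fin n → F) |
    span F {p} ≤ C ∧ C ≤ coordHyperplane F i ∧ finrank F C = 1 + 1}) (t := {C |
    span F {p} ≤ C ∧ C ≤ ⊤ ∧ finrank F C = 1 + 1}) (fun C h => ⟨h.1, le_top, h.2.2⟩)
    (Set.toFinite _)
  have h5 : {C : Submodule F (Fin n → F) | finrank F C = 2 ∧ p ∈ C ∧
      ¬ C ≤ coordHyperplane F i} = {C | span F {p} ≤ C ∧ C ≤ ⊤ ∧ finrank F C = 1 + 1} \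
      {C | span F {p} ≤ C ∧ C ≤ coordHyperplane F i ∧ finrank F C = 1 + 1} := by
    ext C
    simp only [Set.mem_ofPred_eq, Set.mem_sdiff, span_singleton_le_iff_mem, le_top, true_and]
    tauto
  rw [h5]
  omega

/-- Stars whose centre has exactly one zero coordinate are preserved. -/
theorem exists_onlyZeroAt_image (hn : 4 ≤ n) (f : CodeAut F n 2) {p : Fin n → F} {i : Fin n}
    (hp : OnlyZeroAt i p) :
    ∃ (i' : Fin n) (p' : Fin n → F), OnlyZeroAt i' p' ∧ ∀ C, IsCode 2 C → p ∈ C → p' ∈ f C := by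
  have hq : 1 < Nat.card F := Finite.one_lt_card
  have hp0 := hp.ne_zero (by omega)
  set 𝒮 := {C : Submodule F (Fin n → F) | IsCode 2 C ∧ p ∈ C}
  have h𝒮 : 𝒮.ncard = Nat.card F ^ (n - 2) := by
    rw [← ncard_planes_through (by omega) hp0 hp.1]
    congr 1
    ext C
    refine ⟨fun h => ⟨h.1.1, h.2, h.1.not_le i⟩, fun h => ⟨⟨h.1, fun j => ?_⟩, h.2.1⟩⟩
    by_cases hj : j = i
    · subst hj
      exact SetLike.not_le_iff_exists.1 h.2.2
    · exact ⟨p, h.2.1, hp.2 j hj⟩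
  have hinj : Set.InjOn f 𝒮 := fun C hC D hD h => f.injOn hC.1 hD.1 h
  have hcard : (f '' 𝒮).ncard = Nat.card F ^ (n - 2) := by
    rw [hinj.ncard_image, h𝒮]
  have hdp : finrank F (span F {p}) = 1 := finrank_span_singleton hp0
  have hinf : ∀ C ∈ 𝒮, ∀ D ∈ 𝒮, C ≠ D → C ⊓ D = span F {p} := by
    intro C hC D hD hne
    exact inf_eq_of_star (by rw [hC.1.1, hdp]) (by rw [hD.1.1, hdp])
      ((span_singleton_le_iff_mem _ _).2 hC.2) ((span_singleton_le_iff_mem _ _).2 hD.2) hne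
  obtain ⟨A, hA, B, hB, hAB⟩ := (Set.one_lt_ncard (s := 𝒮) (Set.toFinite _)).1 (by
    rw [h𝒮]
    exact Nat.one_lt_pow (by omega) hq)
  rcases clique_star_or_top (𝒦 := f '' 𝒮) (k := 2)
    (by rintro _ ⟨C, hC, rfl⟩; exact (f.map_code hC.1).1)
    (by
      rintro _ ⟨C, hC, rfl⟩ _ ⟨D, hD, rfl⟩ hne
      refine f.map_adj hC.1 hD.1 ?_
      rw [hinf C hC D hD fun h => hne (h ▸ rfl), hdp])
    ⟨A, hA, rfl⟩ ⟨B, hB, rfl⟩ (fun h => hAB (f.injOn hA.1 hB.1 h)) with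
    ⟨S, hS, hall⟩ | ⟨U, hU, hall⟩
  · have hS1 : finrank F S = 1 := by omega
    -- A non-degenerate centre would pull back to a non-degenerate centre contained in `⟨p⟩`, but `p
    -- i = 0`.
    have hnot : ¬ IsCode 1 S := by
      intro hcode
      obtain ⟨T, hT, hTf⟩ := f.symm.exists_star_iff le_rfl (by omega) hcode
      have hTle : ∀ C ∈ 𝒮, T ≤ C := by
        intro C hC
        have := (hTf _ (f.map_code hC.1)).1 (hall _ ⟨C, hC, rfl⟩)
        rwa [f.symm_apply_apply hC.1] at this
      have : T ≤ span F {p} := hinf A hA B hB hAB ▸ le_inf (hTle A hA) (hTle B hB)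
      exact hT.not_le i (this.trans ((span_singleton_le_iff_mem _ _).2 hp.1))
    obtain ⟨i', hi'⟩ := exists_le_coordHyperplane hS1 hnot
    obtain ⟨p', hp'S, hp'0⟩ := exists_mem_ne_zero_of_ne_bot (p := S) (fun h => by
      rw [h, finrank_bot] at hS1
      omega)
    refine ⟨i', p', ⟨hi' hp'S, fun j hj hpj => ?_⟩, fun C hC hpC => hall _ ⟨C, ⟨hC, hpC⟩, rfl⟩ hp'S⟩
    -- The image has `q ^ (n - 2)` members, as many as there are planes through `p'` not inside the
    -- hyperplane of `i'`. A second zero `p' j = 0` would make one of those planes, `⟨e_{i'}, p'⟩`,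
    -- degenerate, leaving too few codes.
    have h1 := ncard_planes_through (by omega) hp'0 (hi' hp'S)
    have hlt : (f '' 𝒮).ncard < Nat.card F ^ (n - 2) := by
      rw [← h1]
      refine Set.ncard_lt_ncard ⟨?_, fun hsub => ?_⟩ (Set.toFinite _)
      · rintro _ ⟨C, hC, rfl⟩
        exact ⟨(f.map_code hC.1).1, hall _ ⟨C, hC, rfl⟩ hp'S, (f.map_code hC.1).not_le i'⟩
      · have hnm : p' ∉ span F {unitVec F i'} :=
          notMem_span_singleton (i := i') (hi' hp'S) (by simp) hp'0
        obtain ⟨C, hC, hCf⟩ := hsub (show span F {unitVec F i', p'} ∈ _ from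
          ⟨finrank_span_pair (unitVec_ne_zero i') hnm, subset_span (by simp), fun h => by
            have := h (subset_span (by simp) : unitVec F i' ∈ span F {unitVec F i', p'})
            simp at this⟩)
        refine not_isCode_of_le (i := j) ?_ (hCf ▸ f.map_code hC.1)
        rw [span_le]
        rintro z (rfl | rfl)
        · exact unitVec_apply_of_ne hj
        · exact hpj
    omega
  -- In a top over `U` there would be at least `q ^ 2` image planes, `q + 1` planes through the
  -- image `x'` of `p + e_i`, at most one of them an image plane, and two degenerate planes. This
  -- exceeds the `q ^ 2 + q + 1` planes of `U`.
  · exfalso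
    obtain ⟨φ, hφ⟩ := exists_point_map hn f
    have hx := hp.nowhereZero_add
    obtain ⟨hx', hxC⟩ := hφ _ hx
    set x := p + unitVec F i
    set x' := φ x
    have hxp : x ∉ span F {p} := fun h => hp.unitVec_notMem (by omega) (by
      simpa [x] using sub_mem h (mem_span_singleton_self p))
    have hC0 : ∀ C ∈ 𝒮, x ∈ C → C = span F {p, x} := fun C hC hx =>
      eq_span_pair hC.1.1 hp0 hC.2 hx hxp
    have hcode0 : IsCode 2 (span F {p, x}) :=
      ⟨finrank_span_pair hp0 hxp, fun j => ⟨x, subset_span (by simp), hx j⟩⟩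
    have hmem0 : span F {p, x} ∈ 𝒮 := ⟨hcode0, subset_span (by simp)⟩
    have hx'U : x' ∈ U :=
      hall _ ⟨_, hmem0, rfl⟩ ((hxC _ hcode0).1 (subset_span (by simp)))
    have hx'd : finrank F (span F {x'}) = 1 := finrank_span_singleton (hx'.ne_zero (by omega))
    set ℬ := {C : Submodule F (Fin n → F) | span F {x'} ≤ C ∧ C ≤ U ∧
      finrank F C = finrank F (span F {x'}) + 1}
    have hℬ : ℬ.ncard = 1 + Nat.card F := by
      rw [ncard_interval ((span_singleton_le_iff_mem _ _).2 hx'U), hU, hx'd]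
      simp [pointCount, Finset.sum_range_succ]
    have hinter : (f '' 𝒮 ∩ ℬ).ncard ≤ 1 := by
      refine (Set.ncard_le_ncard (t := {f (span F {p, x})}) ?_ (Set.toFinite _)).trans
        (Set.ncard_singleton _).le
      rintro _ ⟨⟨C, hC, rfl⟩, h2⟩
      have : x ∈ C := (hxC C hC.1).2 ((span_singleton_le_iff_mem _ _).1 h2.1)
      rw [← hC0 C hC this]
      rfl
    have hUdim : ∀ j, finrank F (U ⊓ coordHyperplane F j : Submodule F (Fin n → F)) = 2 := by
      intro j
      have := finrank_inf_coordHyperplane hx'U (hx' j)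
      omega
    obtain ⟨u, hu, hu0⟩ := exists_mem_ne_zero_of_ne_bot (p := U ⊓ coordHyperplane F i) (fun h => by
      have := hUdim i
      rw [h, finrank_bot] at this
      omega)
    obtain ⟨j, huj⟩ := Function.ne_iff.1 hu0
    set 𝒟 : Set (Submodule F (Fin n → F)) := {U ⊓ coordHyperplane F i, U ⊓ coordHyperplane F j}
    have h𝒟 : 𝒟.ncard = 2 := Set.ncard_pair fun he => huj (he ▸ hu : u ∈ U ⊓ coordHyperplane F j).2
    have hdisj : Disjoint (f '' 𝒮 ∪ ℬ) 𝒟 := by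
      rw [Set.disjoint_left]
      intro C hC hCD
      have hcode : IsCode 2 C := by
        rcases hC with ⟨D, hD, rfl⟩ | hC
        · exact f.map_code hD.1
        · exact (isCode_one_span (by omega) hx').of_le hC.1 (by rw [hC.2.2, hx'd])
      rcases hCD with rfl | rfl
      · exact not_isCode_of_le inf_le_right hcode
      · exact not_isCode_of_le inf_le_right hcode
    have hsub : f '' 𝒮 ∪ ℬ ∪ 𝒟 ⊆ {C : Submodule F (Fin n → F) | C ≤ U ∧ finrank F C = 2} := by
      rintro C ((⟨D, hD, rfl⟩ | hC) | (rfl | rfl))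
      · exact ⟨hall _ ⟨D, hD, rfl⟩, (f.map_code hD.1).1⟩
      · exact ⟨hC.2.1, by rw [hC.2.2, hx'd]⟩
      · exact ⟨inf_le_left, hUdim _⟩
      · exact ⟨inf_le_left, hUdim _⟩
    have h1 := Set.ncard_le_ncard hsub (Set.toFinite _)
    rw [ncard_hyperplanes hU, Set.ncard_union_eq hdisj (Set.toFinite _) (Set.toFinite _), h𝒟] at h1
    have h2 := Set.ncard_union_add_ncard_inter (f '' 𝒮) ℬ (Set.toFinite _) (Set.toFinite _)
    have h3 : Nat.card F ^ 2 ≤ Nat.card F ^ (n - 2) := Nat.pow_le_pow_right (by omega) (by omega)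
    have h4 : pointCount (Nat.card F) (2 + 1) = 1 + Nat.card F + Nat.card F ^ 2 := by
      simp [pointCount, Finset.sum_range_succ]
    omega

theorem ncard_lines {C : Submodule F (Fin n → F)} (hC : finrank F C = 2) :
    {L : Submodule F (Fin n → F) | L ≤ C ∧ finrank F L = 1}.ncard = Nat.card F + 1 := by
  rw [ncard_hyperplanes hC]
  simp [pointCount, Finset.sum_range_succ, add_comm]

/-- Codes containing a standard basis vector are mapped to codes containing a standard basis
vector. -/
theorem exists_unitVec_mem_image (hn : 4 ≤ n) (f : CodeAut F n 2) {C : Submodule F (Fin n → F)}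
    (hC : IsCode 2 C) {i : Fin n} (hi : unitVec F i ∈ C) : ∃ j, unitVec F j ∈ f C := by
  obtain ⟨p, hpC, hp⟩ := hC.exists_onlyZeroAt hi
  obtain ⟨i', p', hp', hall⟩ := exists_onlyZeroAt_image hn f hp
  have hp'C := hall C hC hpC
  have hfC := f.map_code hC
  refine ⟨i', ?_⟩
  by_contra hni
  obtain ⟨g, hg⟩ := f.exists_lower le_rfl (by omega)
  -- Nowhere zero points are compared: `C` has at least `q - 1`, since only `⟨e_i⟩` and `⟨p⟩` are
  -- degenerate, while `f C` without `e_{i'}` would have at most `q - 2`.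
  have hle : {L : Submodule F (Fin n → F) | IsCode 1 L ∧ L ≤ C}.ncard ≤
      {L : Submodule F (Fin n → F) | IsCode 1 L ∧ L ≤ f C}.ncard :=
    Set.ncard_le_ncard_of_injOn g (fun L hL => ⟨g.map_code hL.1, (hg L hL.1 C hC).1 hL.2⟩)
      (fun L hL M hM h => g.injOn hL.1 hM.1 h) (Set.toFinite _)
  have h1 : Nat.card F + 1 ≤
      {L : Submodule F (Fin n → F) | IsCode 1 L ∧ L ≤ C}.ncard + 2 := by
    rw [← ncard_lines hC.1]
    refine (Set.ncard_le_ncard (t := {L | IsCode 1 L ∧ L ≤ C} ∪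
      {span F {unitVec F i}, span F {p}}) ?_ (Set.toFinite _)).trans
      ((Set.ncard_union_le _ _).trans (Nat.add_le_add_left (Set.ncard_insert_le _ _) _ |>.trans
        (by rw [Set.ncard_singleton])))
    rintro L ⟨hLC, hL⟩
    by_cases hcode : IsCode 1 L
    · exact Or.inl ⟨hcode, hLC⟩
    obtain ⟨j, hj⟩ := exists_le_coordHyperplane hL hcode
    obtain ⟨u, hu, hu0⟩ := exists_mem_ne_zero_of_ne_bot (p := L) (fun h => by
      rw [h, finrank_bot] at hL
      omega)
    have hLu : span F {u} = L := eq_of_le_of_finrank_eq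
      ((span_singleton_le_iff_mem _ _).2 hu) (by rw [finrank_span_singleton hu0, hL])
    have huj : u j = 0 := hj hu
    obtain ⟨a, b, rfl⟩ := mem_comb_of_finrank_two hC.1 (hp.ne_zero (by omega)) hpC hi
      (hp.unitVec_notMem (by omega)) (hLC hu)
    right
    rw [← hLu]
    by_cases hji : j = i
    · subst hji
      have hb : b = 0 := by simpa [hp.1] using huj
      subst hb
      have ha : a ≠ 0 := by
        rintro rfl
        simp at hu0
      right
      simp only [zero_smul, add_zero, Set.mem_singleton_iff]
      exact span_singleton_smul_eq (IsUnit.mk0 a ha) p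
    · have ha : a = 0 := by simpa [hji, hp.2 j hji] using huj
      subst ha
      have hb : b ≠ 0 := by
        rintro rfl
        simp at hu0
      left
      simp only [zero_smul, zero_add]
      exact span_singleton_smul_eq (IsUnit.mk0 b hb) _
  have h2 : {L : Submodule F (Fin n → F) | IsCode 1 L ∧ L ≤ f C}.ncard + 3 ≤ Nat.card F + 1 := by
    rw [← ncard_lines hfC.1]
    have hdim : ∀ j, finrank F (f C ⊓ coordHyperplane F j : Submodule F (Fin n → F)) = 1 := by
      intro j
      obtain ⟨x, hx, hxj⟩ := hfC.2 j
      have := finrank_inf_coordHyperplane hx hxj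
      rw [hfC.1] at this
      omega
    obtain ⟨j, hj⟩ := exists_ne_one (by omega) i'
    obtain ⟨u, hu, hu0⟩ := exists_mem_ne_zero_of_ne_bot (p := f C ⊓ coordHyperplane F j)
      (fun h => by
        have := hdim j
        rw [h, finrank_bot] at this
        omega)
    -- Otherwise `u` is a multiple of `e_{i'}`. Coordinates `j` and `l` thus vanish at different
    -- points of `f C`, both different from `⟨p'⟩`: three degenerate points.
    obtain ⟨l, hl, hul⟩ : ∃ l, l ≠ i' ∧ u l ≠ 0 := by
      by_contra! hz
      have hui : u = u i' • unitVec F i' := by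
        ext l
        by_cases h : l = i'
        · subst h; simp
        · simp [h, hz l h]
      have hui0 : u i' ≠ 0 := fun h => hu0 (by rw [hui, h, zero_smul])
      exact hni ((smul_mem_iff _ hui0).1 (hui ▸ hu.1))
    have hlj : f C ⊓ coordHyperplane F j ≠ f C ⊓ coordHyperplane F l :=
      fun h => hul (h ▸ hu : u ∈ f C ⊓ coordHyperplane F l).2
    have hps : ∀ m, m ≠ i' → span F {p'} ≠ f C ⊓ coordHyperplane F m := fun m hm h =>
      hp'.2 m hm (h ▸ mem_span_singleton_self p' : p' ∈ f C ⊓ coordHyperplane F m).2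
    set 𝒟 : Set (Submodule F (Fin n → F)) :=
      {span F {p'}, f C ⊓ coordHyperplane F j, f C ⊓ coordHyperplane F l}
    have h𝒟 : 𝒟.ncard = 3 := by
      rw [Set.ncard_eq_three]
      exact ⟨_, _, _, hps j hj, hps l hl, hlj, rfl⟩
    have hdisj : Disjoint {L : Submodule F (Fin n → F) | IsCode 1 L ∧ L ≤ f C} 𝒟 := by
      rw [Set.disjoint_left]
      rintro L ⟨hL, -⟩ (rfl | rfl | rfl)
      · exact not_isCode_of_le (i := i') ((span_singleton_le_iff_mem _ _).2 hp'.1) hL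
      · exact not_isCode_of_le inf_le_right hL
      · exact not_isCode_of_le inf_le_right hL
    rw [← h𝒟, ← Set.ncard_union_eq hdisj (Set.toFinite _) (Set.toFinite _)]
    refine Set.ncard_le_ncard ?_ (Set.toFinite _)
    rintro L (hL | (rfl | rfl | rfl))
    · exact ⟨hL.2, hL.1.1⟩
    · exact ⟨(span_singleton_le_iff_mem _ _).2 hp'C,
        finrank_span_singleton (hp'.ne_zero (by omega))⟩
    · exact ⟨inf_le_left, hdim _⟩
    · exact ⟨inf_le_left, hdim _⟩
  omega

end Points

/-! ### Pencils of planes and the permutation of the coordinates -/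

section Pencils

variable {F : Type*} [Field F] {n : ℕ}

/-- Two planes with a common non-zero vector are equal or adjacent. That vector may be degenerate,
in which case it has no image of its own. -/
theorem exists_common_image (f : CodeAut F n 2) {C D : Submodule F (Fin n → F)} (hC : IsCode 2 C)
    (hD : IsCode 2 D) {v : Fin n → F} (hv : v ≠ 0) (hvC : v ∈ C) (hvD : v ∈ D) :
    ∃ u, u ≠ 0 ∧ u ∈ f C ∧ u ∈ f D := by
  have hpos : ∀ {A B : Submodule F (Fin n → F)}, 0 < finrank F (A ⊓ B : Submodule F (Fin n → F)) →
      ∃ u, u ≠ 0 ∧ u ∈ A ∧ u ∈ B := by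
    intro A B h
    obtain ⟨u, hu, hu0⟩ := exists_mem_ne_zero_of_ne_bot (p := A ⊓ B) (fun h0 => by
      rw [h0, finrank_bot] at h
      omega)
    exact ⟨u, hu0, hu.1, hu.2⟩
  refine hpos ?_
  by_cases hne : C = D
  · rw [hne, inf_idem, (f.map_code hD).1]
    omega
  have h1 := finrank_inf_lt_of_ne (hC.1.trans hD.1.symm) hne
  rw [hC.1] at h1
  have h2 : 1 ≤ finrank F (C ⊓ D : Submodule F (Fin n → F)) := by
    rw [← finrank_span_singleton (K := F) hv]
    exact finrank_mono ((span_singleton_le_iff_mem _ _).2 ⟨hvC, hvD⟩)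
  have := f.map_adj hC hD (by omega)
  omega

theorem span_pair_add_smul (x : Fin n → F) {v : Fin n → F} (a : F) {b : F} (hb : b ≠ 0) :
    span F {x, a • x + b • v} = span F {x, v} := by
  apply le_antisymm
  · rw [span_le]
    rintro y (rfl | rfl)
    · exact subset_span (by simp)
    · exact mem_span_pair.2 ⟨a, b, rfl⟩
  · rw [span_le]
    rintro y (rfl | rfl)
    · exact subset_span (by simp)
    · refine mem_span_pair.2 ⟨-(b⁻¹ * a), b⁻¹, ?_⟩
      rw [smul_add, smul_smul, smul_smul, inv_mul_cancel₀ hb, neg_smul]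
      simp

theorem notMem_span_of_mem {x u : Fin n → F} {D : Submodule F (Fin n → F)} (hxD : x ∉ D)
    (hu0 : u ≠ 0) (huD : u ∈ D) : u ∉ span F {x} := by
  intro hu
  obtain ⟨a, rfl⟩ := mem_span_singleton.1 hu
  have ha : a ≠ 0 := by
    rintro rfl
    simp at hu0
  exact hxD ((smul_mem_iff _ ha).1 huD)

/-- A plane meeting two planes through `x` and missing `x` lies in their span. -/
theorem transversal_le_sup {x : Fin n → F} (hx : x ≠ 0) {D E₁ E₂ : Submodule F (Fin n → F)}
    (hD : finrank F D = 2) (h₁ : finrank F E₁ = 2) (h₂ : finrank F E₂ = 2)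
    (hx₁ : x ∈ E₁) (hx₂ : x ∈ E₂) (hxD : x ∉ D) (hne : E₁ ≠ E₂)
    (hu₁ : ∃ u, u ≠ 0 ∧ u ∈ D ∧ u ∈ E₁) (hu₂ : ∃ u, u ≠ 0 ∧ u ∈ D ∧ u ∈ E₂) :
    D ≤ E₁ ⊔ E₂ := by
  obtain ⟨u₁, hu₁0, hu₁D, hu₁⟩ := hu₁
  obtain ⟨u₂, hu₂0, hu₂D, hu₂⟩ := hu₂
  have hxs : finrank F (span F {x}) = 1 := finrank_span_singleton hx
  have hinf : E₁ ⊓ E₂ = span F {x} := inf_eq_of_star (by omega) (by omega)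
    ((span_singleton_le_iff_mem _ _).2 hx₁) ((span_singleton_le_iff_mem _ _).2 hx₂) hne
  have h12 : u₂ ∉ span F {u₁} := by
    intro h
    refine notMem_span_of_mem hxD hu₂0 hu₂D (hinf ▸ ⟨?_, hu₂⟩)
    exact (span_singleton_le_iff_mem _ _).2 hu₁ h
  rw [eq_span_pair hD hu₁0 hu₁D hu₂D h12, span_le]
  rintro y (rfl | rfl)
  · exact mem_sup_left hu₁
  · exact mem_sup_right hu₂

/-- A plane meeting three planes of a pencil off the centre forces them to be dependent. -/
theorem le_sup_of_transversal {x : Fin n → F} (hx : x ≠ 0) {D E₁ E₂ E₃ : Submodule F (Fin n → F)}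
    (hD : finrank F D = 2) (h₁ : finrank F E₁ = 2) (h₂ : finrank F E₂ = 2)
    (h₃ : finrank F E₃ = 2) (hx₁ : x ∈ E₁) (hx₂ : x ∈ E₂) (hx₃ : x ∈ E₃) (hxD : x ∉ D)
    (hne : E₁ ≠ E₂) (hu₁ : ∃ u, u ≠ 0 ∧ u ∈ D ∧ u ∈ E₁) (hu₂ : ∃ u, u ≠ 0 ∧ u ∈ D ∧ u ∈ E₂)
    (hu₃ : ∃ u, u ≠ 0 ∧ u ∈ D ∧ u ∈ E₃) : E₃ ≤ E₁ ⊔ E₂ := by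
  have hDle := transversal_le_sup hx hD h₁ h₂ hx₁ hx₂ hxD hne hu₁ hu₂
  obtain ⟨u₃, hu₃0, hu₃D, hu₃⟩ := hu₃
  rw [eq_span_pair h₃ hx hx₃ hu₃ (notMem_span_of_mem hxD hu₃0 hu₃D), span_le]
  rintro y (rfl | rfl)
  · exact mem_sup_left hx₁
  · exact hDle hu₃D

/-- For each nowhere zero `x`, the planes `⟨x, e_i⟩` define an injective index map `D x`. It does
not change when one coordinate of `x` is changed, hence it is constant; and every code containing
`e_i` is such a plane for some `x`. -/
theorem exists_unitVec_perm [Finite F] (hn : 4 ≤ n) (f : CodeAut F n 2) :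
    ∃ δ : Equiv.Perm (Fin n), ∀ C, IsCode 2 C → ∀ i, unitVec F i ∈ C → unitVec F (δ i) ∈ f C := by
  obtain ⟨φ, hφ⟩ := exists_point_map hn f
  have hcode : ∀ {x : Fin n → F}, NowhereZero x → ∀ i, IsCode 2 (span F {x, unitVec F i}) :=
    fun hx i => isCode_span_pair (by omega) hx (unitVec_notMem_span (by omega) hx i)
  have hex : ∀ (x : Fin n → F) (i : Fin n), ∃ j, NowhereZero x →
      unitVec F j ∈ f (span F {x, unitVec F i}) := by
    intro x i
    by_cases hx : NowhereZero x
    · obtain ⟨j, hj⟩ := exists_unitVec_mem_image hn f (i := i) (hcode hx i) (subset_span (by simp))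
      exact ⟨j, fun _ => hj⟩
    · exact ⟨i, fun h => absurd h hx⟩
  choose D hD using hex
  have hφm : ∀ {x : Fin n → F}, NowhereZero x → ∀ i, φ x ∈ f (span F {x, unitVec F i}) :=
    fun hx i => ((hφ _ hx).2 _ (hcode hx i)).1 (subset_span (by simp))
  have himg : ∀ {x : Fin n → F}, NowhereZero x → ∀ i, f (span F {x, unitVec F i}) =
      span F {φ x, unitVec F (D x i)} := fun hx i =>
    eq_span_pair (f.map_code (hcode hx i)).1 ((hφ _ hx).1.ne_zero (by omega)) (hφm hx i) (hD _ i hx)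
      (unitVec_notMem_span (by omega) (hφ _ hx).1 _)
  have hinj : ∀ {x : Fin n → F}, NowhereZero x → Function.Injective (D x) := by
    intro x hx i j hij
    have h := f.injOn (hcode hx i) (hcode hx j) (by rw [himg hx, himg hx, hij])
    have hj : unitVec F j ∈ span F {x, unitVec F j} := subset_span (by simp)
    rw [← h] at hj
    exact unitVec_unique (by omega) (hcode hx i) (subset_span (by simp)) hj
  have h1 : NowhereZero (1 : Fin n → F) := fun _ => one_ne_zero
  have hconst : ∀ {y : Fin n → F}, NowhereZero y → NowhereZero y ∧ D y = D 1 := by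
    intro y hy
    refine nowhereZero_induction (P := fun y => NowhereZero y ∧ D y = D 1) ⟨h1, rfl⟩ ?_ hy
    intro x hx i c hc ih
    have hy : NowhereZero (Function.update x i c) := by
      intro j
      by_cases h : j = i
      · subst h; simpa using hc
      · simpa [h] using hx j
    refine ⟨hy, ?_⟩
    rw [← ih.2]
    rw [update_eq_add] at hy ⊢
    set t := c - x i
    set y := x + t • unitVec F i
    have hxyi : span F {x, unitVec F i} = span F {y, unitVec F i} := by
      refine eq_span_pair (hcode hx i).1 (hy.ne_zero (by omega)) ?_ (subset_span (by simp))
        (unitVec_notMem_span (by omega) hy i)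
      exact mem_span_pair.2 ⟨1, t, by simp [y]⟩
    have hDi : D y i = D x i := unitVec_unique (by omega) (f.map_code (hcode hx i))
      (hxyi ▸ hD y i hy) (hD x i hx)
    by_cases ht : t = 0
    · simp [y, ht]
    funext j
    by_cases hji : j = i
    · rw [hji, hDi]
    obtain ⟨u, hu0, hu1, hu2⟩ := exists_common_image f (hcode hx j) (hcode hy j)
      (unitVec_ne_zero j) (subset_span (by simp)) (subset_span (by simp))
    have hx' := (hφ x hx).1
    have hy'm : φ y ∈ f (span F {x, unitVec F i}) := hxyi ▸ hφm hy i
    rw [himg hx] at hy'm hu1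
    rw [himg hy] at hu2
    obtain ⟨α, β, hαβ⟩ := mem_span_pair.1 hy'm
    obtain ⟨a, b, rfl⟩ := mem_span_pair.1 hu1
    obtain ⟨r, s, hrs⟩ := mem_span_pair.1 hu2
    -- If `β = 0`, then `φ y` is a multiple of `φ x`, so `y` lies on every plane `⟨x, e_l⟩`, which
    -- then contains both `e_i` and `e_l`.
    have hβ : β ≠ 0 := by
      rintro rfl
      have hα : α ≠ 0 := by
        rintro rfl
        exact (hφ y hy).1.ne_zero (by omega) (by rw [← hαβ]; simp)
      obtain ⟨l, hl⟩ := exists_ne_one (by omega) i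
      have hmem : φ y ∈ f (span F {x, unitVec F l}) := by
        rw [← hαβ, zero_smul, add_zero]
        exact smul_mem _ _ (hφm hx l)
      have hyl := ((hφ y hy).2 _ (hcode hx l)).2 hmem
      have hxl : x ∈ span F {x, unitVec F l} := subset_span (by simp)
      have h3 : t • unitVec F i ∈ span F {x, unitVec F l} := by
        simpa [y] using sub_mem hyl hxl
      exact hl (unitVec_unique (by omega) (hcode hx l) (subset_span (by simp))
        ((smul_mem_iff _ ht).1 h3))
    by_contra hne
    have hA : D x j ≠ D x i := fun h => hji (hinj hx h)
    have hB : D y j ≠ D x i := fun h => hji (hinj hy (h.trans hDi.symm))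
    -- A common vector of the images of `⟨x, e_j⟩` and `⟨y, e_j⟩` is read at a fourth index `m`, at
    -- `D x i` and at `D x j`; if `D x j ≠ D y j`, all its coefficients on the `x` side vanish.
    obtain ⟨m, hm1, hm2, hm3⟩ := exists_ne_three hn (D x i) (D x j) (D y j)
    rw [← hαβ] at hrs
    have e1 := congrFun hrs m
    have e2 := congrFun hrs (D x i)
    have e3 := congrFun hrs (D x j)
    simp only [Pi.add_apply, Pi.smul_apply, smul_eq_mul, unitVec_apply_of_ne hm1,
      unitVec_apply_of_ne hm2, unitVec_apply_of_ne hm3, mul_zero, add_zero] at e1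
    simp only [Pi.add_apply, Pi.smul_apply, smul_eq_mul, unitVec_apply_of_ne hA.symm,
      unitVec_apply_of_ne hB.symm, mul_zero, add_zero, Pi.single_eq_same, mul_one] at e2
    simp only [Pi.add_apply, Pi.smul_apply, smul_eq_mul, unitVec_apply_of_ne hA,
      unitVec_apply_of_ne (Ne.symm hne), mul_zero, add_zero, Pi.single_eq_same, mul_one] at e3
    have hra : r * α = a := mul_right_cancel₀ (hx' m) (by linear_combination e1)
    have hr : r = 0 := by
      have : r * β = 0 := by linear_combination e2 - φ x (D x i) * hra
      simpa [hβ] using this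
    subst hr
    have ha : a = 0 := by simpa using hra.symm
    subst ha
    have hb : b = 0 := by simpa using e3.symm
    simp [hb] at hu0
  refine ⟨Equiv.ofBijective (D 1) (Finite.injective_iff_bijective.1 (hinj h1)), fun C hC i hi => ?_⟩
  obtain ⟨p, hpC, hp⟩ := hC.exists_onlyZeroAt hi
  have hx := hp.nowhereZero_add
  have hCx := eq_span_pair hC.1 (hx.ne_zero (by omega)) (add_mem hpC hi) hi
    (unitVec_notMem_span (by omega) hx i)
  rw [hCx]
  have := hD _ i hx
  rwa [(hconst hx).2] at this

end Pencils

/-! ### Recognizing a field automorphism -/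

section FieldAutomorphism

/-- A multiplicative map commuting with `t ↦ 1 - t` is a field automorphism. -/
theorem exists_ringEquiv_of_map_one_sub {F : Type*} [Field F] [Finite F] {s : F → F} (h0 : s 0 = 0)
    (h1 : s 1 = 1) (hmul : ∀ a b, s (a * b) = s a * s b) (hsub : ∀ t, s (1 - t) = 1 - s t) :
    ∃ σ : F ≃+* F, ∀ t, σ t = s t := by
  have hne : ∀ a, a ≠ 0 → s a ≠ 0 := by
    intro a ha h
    have := hmul a a⁻¹
    rw [mul_inv_cancel₀ ha, h1, h, zero_mul] at this
    exact one_ne_zero this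
  have hneg1 : s (-1) = -1 := by
    -- If `s (-1) = 1`, then `s 2 = s (1 - (-1)) = 0`, so `2 = 0` and the two signs agree.
    have h2 : (s (-1) - 1) * (s (-1) + 1) = 0 := by
      have := hmul (-1) (-1)
      rw [neg_mul_neg, one_mul, h1] at this
      linear_combination -this
    rcases mul_eq_zero.1 h2 with h | h
    · have h3 := hsub (-1)
      rw [sub_eq_zero.1 h, sub_self] at h3
      by_contra
      have h4 : (1 : F) - -1 = 0 := by
        by_contra h5
        exact hne _ h5 h3
      rw [sub_eq_zero.1 h] at this
      exact this (by linear_combination h4)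
    · linear_combination h
  have hneg : ∀ a, s (-a) = -s a := by
    intro a
    rw [← neg_one_mul, hmul, hneg1, neg_one_mul]
  have hadd : ∀ a b, s (a + b) = s a + s b := by
    intro a b
    by_cases ha : a = 0
    · simp [ha, h0]
    have : a + b = a * (1 - -b * a⁻¹) := by field_simp; ring
    have h2 : s b = s a * s (b * a⁻¹) := by rw [← hmul]; congr 1; field_simp
    rw [this, hmul, hsub, neg_mul, hneg, h2]
    ring
  let φ : F →+* F := ⟨⟨⟨s, h1⟩, hmul⟩, h0, hadd⟩
  exact ⟨RingEquiv.ofBijective φ (Finite.injective_iff_bijective.1 φ.injective), fun t => rfl⟩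

/-- A function of three distinct indices which is unchanged when one of them is replaced by a
fourth one is constant. -/
theorem eq_of_replace {n : ℕ} (hn : 4 ≤ n) {X : Type*} (h : Fin n → Fin n → Fin n → X)
    (h1 : ∀ i j k l, i ≠ j → i ≠ k → j ≠ k → l ≠ i → l ≠ j → l ≠ k → h i j k = h l j k)
    (h2 : ∀ i j k l, i ≠ j → i ≠ k → j ≠ k → l ≠ i → l ≠ j → l ≠ k → h i j k = h i l k)
    (h3 : ∀ i j k l, i ≠ j → i ≠ k → j ≠ k → l ≠ i → l ≠ j → l ≠ k → h i j k = h i j l)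
    {i j k a b c : Fin n} (hij : i ≠ j) (hik : i ≠ k) (hjk : j ≠ k) (hab : a ≠ b) (hac : a ≠ c)
    (hbc : b ≠ c) : h i j k = h a b c := by
  -- A transposition is three replacements, with a fourth index as temporary storage.
  have s12 : ∀ i j k, i ≠ j → i ≠ k → j ≠ k → h i j k = h j i k := by
    intro i j k hij hik hjk
    obtain ⟨l, hl1, hl2, hl3⟩ := exists_ne_three hn i j k
    rw [h1 i j k l, h2 l j k i, h1 l i k j] <;> first | assumption | (symm; assumption)
  have s13 : ∀ i j k, i ≠ j → i ≠ k → j ≠ k → h i j k = h k j i := by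
    intro i j k hij hik hjk
    obtain ⟨l, hl1, hl2, hl3⟩ := exists_ne_three hn i j k
    rw [h1 i j k l, h3 l j k i, h1 l j i k] <;> first | assumption | (symm; assumption)
  have s23 : ∀ i j k, i ≠ j → i ≠ k → j ≠ k → h i j k = h i k j := by
    intro i j k hij hik hjk
    obtain ⟨l, hl1, hl2, hl3⟩ := exists_ne_three hn i j k
    rw [h2 i j k l, h3 i l k j, h2 i l j k] <;> first | assumption | (symm; assumption)
  have step1 : ∃ j' k', a ≠ j' ∧ a ≠ k' ∧ j' ≠ k' ∧ h i j k = h a j' k' := by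
    by_cases hai : a = i
    · exact ⟨j, k, hai ▸ hij, hai ▸ hik, hjk, hai ▸ rfl⟩
    by_cases haj : a = j
    · exact ⟨i, k, hai, haj ▸ hjk, hik, haj ▸ s12 i j k hij hik hjk⟩
    by_cases hak : a = k
    · exact ⟨j, i, haj, hai, hij.symm, hak ▸ s13 i j k hij hik hjk⟩
    exact ⟨j, k, haj, hak, hjk, h1 i j k a hij hik hjk hai haj hak⟩
  obtain ⟨j', k', haj, hak, hjk', e1⟩ := step1
  have step2 : ∃ k'', a ≠ k'' ∧ b ≠ k'' ∧ h a j' k' = h a b k'' := by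
    by_cases hbj : b = j'
    · exact ⟨k', hak, hbj ▸ hjk', hbj ▸ rfl⟩
    by_cases hbk : b = k'
    · exact ⟨j', haj, hbj, hbk ▸ s23 a j' k' haj hak hjk'⟩
    exact ⟨k', hak, hbk, h2 a j' k' b haj hak hjk' hab.symm hbj hbk⟩
  obtain ⟨k'', hak'', hbk'', e2⟩ := step2
  rw [e1, e2]
  by_cases hck : c = k''
  · rw [hck]
  · exact h3 a b k'' c hab hak'' hbk'' hac.symm hbc.symm hck

end FieldAutomorphism

/-! ### Coordinatizing the pencil of the all-one vector -/

section Coordinatization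

variable {F : Type*} [Field F] {n : ℕ}

/-- `f` preserves the pencil of the all-one vector and, for every `i`, the pencil of the `i`-th
standard basis vector. -/
structure PreservesFrame (f : CodeAut F n 2) : Prop where
  one_mem_iff : ∀ C, IsCode 2 C → ((1 : Fin n → F) ∈ C ↔ (1 : Fin n → F) ∈ f C)
  unitVec_mem : ∀ C, IsCode 2 C → ∀ i, unitVec F i ∈ C → unitVec F i ∈ f C

/-- `f` maps the line spanned by `1` and `v` to the line spanned by `1` and `w`. -/
def PencilRel (f : CodeAut F n 2) (v w : Fin n → F) : Prop :=
  v ∉ span F {(1 : Fin n → F)} ∧ f (span F {1, v}) = span F {1, w}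

theorem nowhereZero_one : NowhereZero (1 : Fin n → F) := fun _ => one_ne_zero

theorem notMem_span_one {v : Fin n → F} {i j : Fin n} (h : v i ≠ v j) :
    v ∉ span F {(1 : Fin n → F)} := by
  intro hv
  obtain ⟨a, rfl⟩ := mem_span_singleton.1 hv
  simp at h

theorem exists_ne_of_notMem_span_one {v : Fin n → F} (h : v ∉ span F {(1 : Fin n → F)})
    (i : Fin n) : ∃ j, v j ≠ v i := by
  by_contra! hall
  exact h (mem_span_singleton.2 ⟨v i, by ext j; simp [hall j]⟩)

theorem isCode_span_one (hn : 0 < n) {v : Fin n → F} (h : v ∉ span F {(1 : Fin n → F)}) :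
    IsCode 2 (span F {1, v}) :=
  isCode_span_pair hn nowhereZero_one h

theorem span_one_unitVec_eq (hn : 2 ≤ n) {v : Fin n → F} {i : Fin n}
    (h : v ∉ span F {(1 : Fin n → F)}) (hv : v ∈ span F {1, unitVec F i}) :
    span F {1, v} = span F {1, unitVec F i} := by
  have h1 : (1 : Fin n → F) ≠ 0 := nowhereZero_one.ne_zero (by omega)
  have h2 := finrank_span_pair h1 (unitVec_notMem_span hn nowhereZero_one i)
  exact (eq_span_pair h2 h1 (subset_span (by simp)) hv h).symm

namespace PreservesFrame

theorem span_one_unitVec {f : CodeAut F n 2} (hf : PreservesFrame f) (hn : 2 ≤ n) (i : Fin n) :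
    f (span F {1, unitVec F i}) = span F {1, unitVec F i} := by
  have hi := unitVec_notMem_span (F := F) hn nowhereZero_one i
  have hc := isCode_span_one (by omega) hi
  exact eq_span_pair (f.map_code hc).1 (nowhereZero_one.ne_zero (by omega))
    ((hf.one_mem_iff _ hc).1 (subset_span (by simp)))
    (hf.unitVec_mem _ hc i (subset_span (by simp))) hi

theorem exists_pencilRel {f : CodeAut F n 2} (hf : PreservesFrame f) (hn : 2 ≤ n) {v : Fin n → F}
    (hv : v ∉ span F {(1 : Fin n → F)}) : ∃ w, PencilRel f v w := by
  have hc := isCode_span_one (by omega) hv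
  have hfc := f.map_code hc
  have h1 : finrank F (span F {(1 : Fin n → F)}) = 1 :=
    finrank_span_singleton (nowhereZero_one.ne_zero (by omega))
  obtain ⟨w, hw, hw1⟩ := exists_mem_notMem_of_finrank_lt (S := span F {(1 : Fin n → F)})
    (T := f (span F {1, v})) (by rw [hfc.1, h1]; omega)
  exact ⟨w, hv, eq_span_pair hfc.1 (nowhereZero_one.ne_zero (by omega))
    ((hf.one_mem_iff _ hc).1 (subset_span (by simp))) hw hw1⟩

end PreservesFrame

theorem PencilRel.right_notMem {f : CodeAut F n 2} {v w : Fin n → F} (hn : 0 < n)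
    (h : PencilRel f v w) : w ∉ span F {(1 : Fin n → F)} := by
  intro hw
  have h1 := (f.map_code (isCode_span_one hn h.1)).1
  have h2 : span F {1, w} = span F {(1 : Fin n → F)} := by
    rw [span_pair_eq_sup, sup_eq_left, span_singleton_le_iff_mem]
    exact hw
  rw [h.2, h2, finrank_span_singleton (nowhereZero_one.ne_zero hn)] at h1
  omega

/-- The partner `w` is unique only up to `w ↦ a • 1 + b • w`, so only ratios of coordinate
differences are well defined. -/
theorem PencilRel.exists_comb {f : CodeAut F n 2} {v v' w w' : Fin n → F} (hn : 0 < n)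
    (h : PencilRel f v w) (h' : PencilRel f v' w') (hv : span F {1, v} = span F {1, v'}) :
    ∃ a b : F, b ≠ 0 ∧ w' = a • 1 + b • w := by
  have hw' : w' ∈ span F {1, w} := by
    rw [← h.2, hv, h'.2]
    exact subset_span (by simp)
  obtain ⟨a, b, hab⟩ := mem_span_pair.1 hw'
  refine ⟨a, b, ?_, hab.symm⟩
  rintro rfl
  exact h'.right_notMem hn (mem_span_singleton.2 ⟨a, by simpa using hab⟩)

/-- The pencils of the standard basis vectors are preserved. -/
theorem PencilRel.exists_add_unitVec {f : CodeAut F n 2} (hf : PreservesFrame f) (hn : 3 ≤ n)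
    {v w : Fin n → F} (h : PencilRel f v w) {i : Fin n} {c : F}
    (hv' : v + c • unitVec F i ∉ span F {(1 : Fin n → F)}) :
    ∃ c' : F, PencilRel f (v + c • unitVec F i) (w + c' • unitVec F i) := by
  have h10 : (1 : Fin n → F) ≠ 0 := nowhereZero_one.ne_zero (by omega)
  by_cases hvi : v ∈ span F {1, unitVec F i}
  · refine ⟨0, hv', ?_⟩
    have hv'i : v + c • unitVec F i ∈ span F {1, unitVec F i} :=
      add_mem hvi (smul_mem _ _ (subset_span (by simp)))
    rw [zero_smul, add_zero, ← h.2, span_one_unitVec_eq (by omega) hv' hv'i,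
      span_one_unitVec_eq (by omega) h.1 hvi]
  set v' := v + c • unitVec F i
  set t := v i - 1
  -- The plane `⟨b, d⟩` with `d = 1 - e_i` is a code, by `b` at coordinate `i` and `d` elsewhere. It
  -- misses `1` and meets `⟨1, v⟩`, `⟨1, e_i⟩`, `⟨1, v'⟩` in `b`, `d`, `b - c • d`. Its image shows
  -- that the images of these three planes are dependent.
  set b := v - t • (1 : Fin n → F)
  have hbi : b i = 1 := by simp [b, t]
  have hi := unitVec_notMem_span (F := F) (by omega) nowhereZero_one i
  have hc₁ := isCode_span_one (by omega) h.1
  have hc₂ := isCode_span_one (by omega) hi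
  have hc₃ := isCode_span_one (by omega) hv'
  obtain ⟨j, hj⟩ := exists_ne_one (by omega) i
  set d : Fin n → F := 1 - unitVec F i
  have hd0 : d ≠ 0 := fun h0 => by simpa [d, hj] using congrFun h0 j
  have hdi : d i = 0 := by simp [d]
  have hb0 : b ≠ 0 := fun h0 => by simp [h0] at hbi
  have hdb : d ∉ span F {b} := notMem_span_singleton (i := i) hdi (by simp [hbi]) hd0
  have hdD : d ∈ span F {b, d} := subset_span (by simp)
  have hbD : b ∈ span F {b, d} := subset_span (by simp)
  have hcD : IsCode 2 (span F {b, d}) := by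
    refine ⟨finrank_span_pair hb0 hdb, fun l => ?_⟩
    by_cases hl : l = i
    · exact ⟨b, hbD, by simp [hl, hbi]⟩
    · exact ⟨d, hdD, by simp [d, hl]⟩
  have h1D : (1 : Fin n → F) ∉ span F {b, d} := by
    intro h1
    obtain ⟨β, α, hαβ⟩ := mem_span_pair.1 h1
    have e1 := congrFun hαβ i
    have hβ : β = 1 := by simpa [hbi, hdi] using e1
    subst hβ
    refine hvi (mem_span_pair.2 ⟨1 + t - α, α, ?_⟩)
    simp only [b, d, one_smul] at hαβ
    rw [smul_sub] at hαβ
    rw [sub_smul, add_smul, one_smul]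
    linear_combination -hαβ
  have hne : span F {1, v} ≠ span F {1, unitVec F i} := fun he =>
    hvi (he ▸ subset_span (by simp))
  have hx₁ : (1 : Fin n → F) ∈ span F {1, v} := subset_span (by simp)
  have hx₂ : (1 : Fin n → F) ∈ span F {1, unitVec F i} := subset_span (by simp)
  have hx₃ : (1 : Fin n → F) ∈ span F {1, v'} := subset_span (by simp)
  have hle := le_sup_of_transversal h10 (f.map_code hcD).1 (f.map_code hc₁).1 (f.map_code hc₂).1
    (f.map_code hc₃).1 ((hf.one_mem_iff _ hc₁).1 hx₁) ((hf.one_mem_iff _ hc₂).1 hx₂)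
    ((hf.one_mem_iff _ hc₃).1 hx₃) (fun h1 => h1D ((hf.one_mem_iff _ hcD).2 h1))
    (fun he => hne (f.injOn hc₁ hc₂ he))
    (exists_common_image f hcD hc₁ hb0 hbD (mem_span_pair.2 ⟨-t, 1, by
      simp only [b, neg_smul, one_smul]; abel⟩))
    (exists_common_image f hcD hc₂ hd0 hdD (mem_span_pair.2 ⟨1, -1, by
      simp only [d, neg_smul, one_smul]; abel⟩))
    (exists_common_image f hcD hc₃ (v := b - c • d)
      (fun h0 => hb0 (by
        rw [sub_eq_zero.1 h0] at hbi
        simp [hdi] at hbi))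
      (sub_mem hbD (smul_mem _ _ hdD)) (mem_span_pair.2 ⟨-t - c, 1, by
        simp only [b, d, v', one_smul, sub_smul, neg_smul, smul_sub]; abel⟩))
  obtain ⟨w'', hw''⟩ := hf.exists_pencilRel (by omega) hv'
  have hmem : w'' ∈ f (span F {1, v'}) := by
    rw [hw''.2]
    exact subset_span (by simp)
  have hmem2 := hle hmem
  rw [h.2, hf.span_one_unitVec (by omega)] at hmem2
  obtain ⟨y, hy, z, hz, hyz⟩ := mem_sup.1 hmem2
  obtain ⟨α₁, β, rfl⟩ := mem_span_pair.1 hy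
  obtain ⟨α₂, γ, rfl⟩ := mem_span_pair.1 hz
  have hβ : β ≠ 0 := by
    rintro rfl
    have h4 : w'' ∈ span F {1, unitVec F i} := by
      refine mem_span_pair.2 ⟨α₁ + α₂, γ, ?_⟩
      rw [← hyz, add_smul, zero_smul]
      abel
    have h5 := hw''.2
    rw [span_one_unitVec_eq (by omega) (hw''.right_notMem (by omega)) h4,
      ← hf.span_one_unitVec (by omega) i] at h5
    have h6 := f.injOn hc₃ hc₂ h5
    have h7 : v' ∈ span F {1, unitVec F i} := h6 ▸ subset_span (by simp)
    have h8 := sub_mem h7 (smul_mem _ c (subset_span (by simp) :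
      unitVec F i ∈ span F {1, unitVec F i}))
    exact hvi (by simpa [v'] using h8)
  refine ⟨β⁻¹ * γ, hv', ?_⟩
  rw [hw''.2, ← span_pair_add_smul 1 (α₁ + α₂) hβ (v := w + (β⁻¹ * γ) • unitVec F i)]
  congr 2
  rw [← hyz, smul_add, smul_smul, mul_inv_cancel_left₀ hβ, add_smul]
  abel_nf

/-- The restriction of the image to a set of coordinates depends only on the restriction of the
argument to it. -/
theorem PencilRel.exists_of_eqOn {f : CodeAut F n 2} (hf : PreservesFrame f) (hn : 3 ≤ n)
    {v v' w : Fin n → F} (h : PencilRel f v w) {T : Set (Fin n)} (heq : ∀ k ∈ T, v' k = v k)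
    {i j : Fin n} (hi : i ∈ T) (hj : j ∈ T) (hij : v i ≠ v j) :
    ∃ w', PencilRel f v' w' ∧ ∀ k ∈ T, w' k = w k := by
  classical
  have key : ∀ s : Finset (Fin n), ∃ w', PencilRel f (s.piecewise v' v) w' ∧
      ∀ k ∈ T, w' k = w k := by
    intro s
    induction s using Finset.induction_on with
    | empty => exact ⟨w, by simpa using h, fun _ _ => rfl⟩
    | insert l s _ ih =>
      obtain ⟨w', hw', hT⟩ := ih
      have hval : ∀ (s : Finset (Fin n)), ∀ k ∈ T, s.piecewise v' v k = v k := by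
        intro s k hk
        by_cases hks : k ∈ s
        · simp [hks, heq k hk]
        · simp [hks]
      by_cases hl : l ∈ T
      · refine ⟨w', ?_, hT⟩
        rw [Finset.piecewise_insert, heq l hl, ← hval s l hl, Function.update_eq_self]
        exact hw'
      -- The coordinates `i` and `j` of `T` never change, which keeps every intermediate vector off
      -- `⟨1⟩`.
      · have hnot : (insert l s).piecewise v' v ∉ span F {(1 : Fin n → F)} :=
          notMem_span_one (i := i) (j := j) (by rw [hval _ i hi, hval _ j hj]; exact hij)
        rw [Finset.piecewise_insert, update_eq_add] at hnot ⊢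
        obtain ⟨c', hc'⟩ := hw'.exists_add_unitVec hf hn hnot
        refine ⟨_, hc', fun k hk => ?_⟩
        have hkl : k ≠ l := fun he => hl (he ▸ hk)
        simp [hkl, hT k hk]
  simpa using key Finset.univ

/-- On `{i, j, k}` the vector `v` agrees with one spanning the fixed plane `⟨1, e_i⟩` together with
`1`, so there `w` agrees with some `a • 1 + b • e_i`, `b ≠ 0`. -/
theorem PencilRel.apply_eq_and_ne {f : CodeAut F n 2} (hf : PreservesFrame f) (hn : 3 ≤ n)
    {v w : Fin n → F} (h : PencilRel f v w) {i j k : Fin n} (hij : v i ≠ v j) (hjk : v j = v k) :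
    w i ≠ w j ∧ w j = w k := by
  have hji : j ≠ i := fun he => hij (by rw [he])
  have hki : k ≠ i := fun he => hij (by rw [hjk, he])
  have hsub : v i - v j ≠ 0 := sub_ne_zero.2 hij
  obtain ⟨w', hw', hT⟩ := h.exists_of_eqOn hf hn (T := {i, j, k}) (i := i) (j := j)
    (v' := v j • 1 + (v i - v j) • unitVec F i) (by
      rintro l (rfl | rfl | rfl)
      · simp
      · simp [hji]
      · simp [hki, hjk]) (by simp) (by simp) hij
  have h1 := hw'.2
  rw [span_pair_add_smul 1 _ hsub, hf.span_one_unitVec (by omega)] at h1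
  have h2 : w' ∈ span F {1, unitVec F i} := by
    rw [h1]
    exact subset_span (by simp)
  obtain ⟨a, b, rfl⟩ := mem_span_pair.1 h2
  have hb : b ≠ 0 := by
    rintro rfl
    exact hw'.right_notMem (by omega) (mem_span_singleton.2 ⟨a, by simp⟩)
  rw [← hT i (by simp), ← hT j (by simp), ← hT k (by simp)]
  simp [hji, hki, hb]

theorem PencilRel.apply_ne {f : CodeAut F n 2} (hf : PreservesFrame f) (hn : 3 ≤ n)
    {v w : Fin n → F} (h : PencilRel f v w) {i j : Fin n} (hij : v i ≠ v j) : w i ≠ w j :=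
  (h.apply_eq_and_ne hf hn hij rfl).1

/-- Affine ratios are transformed by functions depending only on the indices. -/
theorem exists_ratio_map {f : CodeAut F n 2} (hf : PreservesFrame f) (hn : 3 ≤ n) :
    ∃ α : Fin n → Fin n → Fin n → F → F, ∀ i j k, i ≠ j → i ≠ k → j ≠ k →
      ∀ v w, PencilRel f v w → v i ≠ v j →
        w k - w i = α i j k ((v k - v i) / (v j - v i)) * (w j - w i) := by
  have hex : ∀ (i j k : Fin n) (t : F), ∃ w, i ≠ j → i ≠ k → j ≠ k →
      PencilRel f (unitVec F j + t • unitVec F k) w := by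
    intro i j k t
    by_cases h : unitVec F j + t • unitVec F k ∈ span F {(1 : Fin n → F)}
    · refine ⟨0, fun hij hik hjk => absurd h (notMem_span_one (i := i) (j := j) ?_)⟩
      simp [hij, hik, hjk]
    · obtain ⟨w, hw⟩ := hf.exists_pencilRel (by omega) h
      exact ⟨w, fun _ _ _ => hw⟩
  choose W hW using hex
  -- The model `e_j + t e_k` has values `0, 1, t` at `i, j, k`. On these indices any `v` with ratio
  -- `t` is an affine transform of it, and locality carries the ratio over.
  refine ⟨fun i j k t => (W i j k t k - W i j k t i) / (W i j k t j - W i j k t i), ?_⟩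
  intro i j k hij hik hjk v w hvw hne
  dsimp only
  set t := (v k - v i) / (v j - v i) with ht
  have hji : v j - v i ≠ 0 := sub_ne_zero.2 hne.symm
  set v₀ := unitVec F j + t • unitVec F k
  have hv₀ := hW i j k t hij hik hjk
  have hv₀ij : v₀ i ≠ v₀ j := by simp [v₀, hij, hik, hjk]
  have hW0 : W i j k t j - W i j k t i ≠ 0 := sub_ne_zero.2 (hv₀.apply_ne hf hn hv₀ij).symm
  obtain ⟨w', hw', hT⟩ := hvw.exists_of_eqOn hf hn (T := {i, j, k}) (i := i) (j := j)
    (v' := v i • 1 + (v j - v i) • v₀) (by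
      rintro l (rfl | rfl | rfl)
      · simp [v₀, hij, hik]
      · simp [v₀, hjk]
      · simp [v₀, hjk.symm, ht, mul_div_cancel₀ _ hji]) (by simp) (by simp) hne
  obtain ⟨a, b, hb, hab⟩ := hv₀.exists_comb (by omega) hw' (span_pair_add_smul 1 _ hji).symm
  rw [← hT i (by simp), ← hT j (by simp), ← hT k (by simp), hab]
  simp only [Pi.add_apply, Pi.smul_apply, Pi.one_apply, smul_eq_mul, mul_one]
  field_simp
  ring

/-- An index is replaced by a fourth one using a vector with equal values at both: its image also
has equal values there, so the two ratio maps agree at `t`. Then `eq_of_replace` applies. -/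
theorem exists_common_ratio_map {f : CodeAut F n 2} (hf : PreservesFrame f) (hn : 4 ≤ n) :
    ∃ s : F → F, ∀ i j k, i ≠ j → i ≠ k → j ≠ k →
      ∀ v w, PencilRel f v w → v i ≠ v j →
        w k - w i = s ((v k - v i) / (v j - v i)) * (w j - w i) := by
  obtain ⟨α, hα⟩ := exists_ratio_map hf (by omega)
  have hn3 : 3 ≤ n := by omega
  have hrel : ∀ {v : Fin n → F} (i j : Fin n), v i ≠ v j → ∃ w, PencilRel f v w :=
    fun i j h => hf.exists_pencilRel (by omega) (notMem_span_one h)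
  have hconst := @eq_of_replace n hn (F → F) α
    (fun i j k l hij hik hjk hli hlj hlk => by
      funext t
      obtain ⟨w, hw⟩ := hrel (v := unitVec F j + t • unitVec F k) i j
        (by simp [hij, hik, hjk])
      have e := hw.apply_eq_and_ne hf hn3 (i := j) (j := i) (k := l)
        (by simp [hij, hik, hjk]) (by simp [hij, hik, hlj, hlk])
      have h1 := hα i j k hij hik hjk _ _ hw (by simp [hij, hik, hjk])
      have h2 := hα l j k hlj hlk hjk _ _ hw (by simp [hlj, hlk, hjk])
      simp [hij, hik, hjk, hjk.symm] at h1
      simp [hlj, hlk, hjk, hjk.symm] at h2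
      rw [← e.2, h1] at h2
      exact mul_right_cancel₀ (sub_ne_zero.2 e.1) h2)
    (fun i j k l hij hik hjk hli hlj hlk => by
      funext t
      obtain ⟨w, hw⟩ := hrel (v := unitVec F j + unitVec F l + t • unitVec F k) i j
        (by simp [hij, hik, hjk, hli.symm, hlj.symm])
      have e := hw.apply_eq_and_ne hf hn3 (i := i) (j := j) (k := l)
        (by simp [hij, hik, hjk, hli.symm, hlj.symm])
        (by simp [hlj, hlk, hjk, hlj.symm])
      have h1 := hα i j k hij hik hjk _ _ hw (by simp [hij, hik, hjk, hli.symm, hlj.symm])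
      have h2 := hα i l k hli.symm hik hlk _ _ hw (by simp [hij, hik, hlk, hli.symm, hlj])
      simp [hij, hik, hjk, hjk.symm, hli.symm, hlj.symm, hlk.symm] at h1
      simp [hij, hik, hlk, hlk.symm, hli.symm, hlj, hjk.symm] at h2
      rw [← e.2, h1] at h2
      exact mul_right_cancel₀ (sub_ne_zero.2 e.1.symm) h2)
    (fun i j k l hij hik hjk hli hlj hlk => by
      funext t
      obtain ⟨w, hw⟩ := hrel (v := unitVec F j + t • (unitVec F k + unitVec F l)) i j
        (by simp [hij, hik, hjk, hli.symm, hlj.symm])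
      have e := hw.apply_ne hf hn3 (i := i) (j := j)
        (by simp [hij, hik, hjk, hli.symm, hlj.symm])
      have e' : w k = w l := by
        -- Equality at `k` and `l` must be tested against an index with another value: `j` if `t =
        -- 0`, and `i` otherwise.
        by_cases ht : t = 0
        · exact (hw.apply_eq_and_ne hf hn3 (i := j) (j := k) (k := l)
            (by simp [ht, hjk]) (by simp [ht, hjk.symm, hlj])).2
        · exact (hw.apply_eq_and_ne hf hn3 (i := i) (j := k) (k := l)
            (by simp [hij, hik, hjk.symm, hli.symm, hlk.symm, Ne.symm ht])
            (by simp [hjk.symm, hlj, hlk, hlk.symm])).2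
      have h1 := hα i j k hij hik hjk _ _ hw (by simp [hij, hik, hjk, hli.symm, hlj.symm])
      have h2 := hα i j l hij hli.symm hlj.symm _ _ hw
        (by simp [hij, hik, hjk, hli.symm, hlj.symm])
      simp [hij, hik, hjk, hjk.symm, hli.symm, hlj.symm, hlk.symm] at h1
      simp [hij, hik, hjk, hlj, hlk, hli.symm, hlj.symm] at h2
      rw [← e', h1] at h2
      exact mul_right_cancel₀ (sub_ne_zero.2 e.symm) h2)
  let i₀ : Fin n := ⟨0, by omega⟩
  let j₀ : Fin n := ⟨1, by omega⟩
  let k₀ : Fin n := ⟨2, by omega⟩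
  refine ⟨α i₀ j₀ k₀, fun i j k hij hik hjk v w hvw hne => ?_⟩
  rw [← hconst hij hik hjk (a := i₀) (b := j₀) (c := k₀) (by simp [i₀, j₀]) (by simp [i₀, k₀])
    (by simp [j₀, k₀])]
  exact hα i j k hij hik hjk v w hvw hne

/-- An automorphism preserving the frame acts on the codes containing `1` by a field
automorphism. -/
theorem PreservesFrame.exists_ringEquiv [Finite F] {f : CodeAut F n 2} (hf : PreservesFrame f)
    (hn : 4 ≤ n) : ∃ σ : F ≃+* F, ∀ v, v ∉ span F {(1 : Fin n → F)} →
      f (span F {1, v}) = span F {1, fun k => σ (v k)} := by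
  obtain ⟨s, hs⟩ := exists_common_ratio_map hf hn
  have hn3 : 3 ≤ n := by omega
  let i : Fin n := ⟨0, by omega⟩
  let j : Fin n := ⟨1, by omega⟩
  let k : Fin n := ⟨2, by omega⟩
  let l : Fin n := ⟨3, by omega⟩
  have hij : i ≠ j := by simp [i, j]
  have hik : i ≠ k := by simp [i, k]
  have hil : i ≠ l := by simp [i, l]
  have hjk : j ≠ k := by simp [j, k]
  have hjl : j ≠ l := by simp [j, l]
  have hkl : k ≠ l := by simp [k, l]
  have hrel : ∀ a b : F, ∃ w, PencilRel f (unitVec F j + a • unitVec F k + b • unitVec F l) w ∧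
      w j - w i ≠ 0 := by
    intro a b
    have hne : (unitVec F j + a • unitVec F k + b • unitVec F l) i ≠
        (unitVec F j + a • unitVec F k + b • unitVec F l) j := by
      simp [hij, hik, hil, hjk, hjl]
    obtain ⟨w, hw⟩ := hf.exists_pencilRel (by omega) (notMem_span_one hne)
    exact ⟨w, hw, sub_ne_zero.2 (hw.apply_ne hf hn3 hne).symm⟩
  have h0 : s 0 = 0 := by
    obtain ⟨w, hw, hne⟩ := hrel 0 0
    have h1 := hs i j k hij hik hjk _ _ hw (by simp [hij])
    have h2 := (hw.apply_eq_and_ne hf hn3 (i := j) (j := i) (k := k) (by simp [hij])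
      (by simp [hij, hjk.symm])).2
    simp [hij, hjk.symm] at h1
    rw [h2, sub_self, eq_comm, mul_eq_zero] at h1
    exact h1.resolve_right (h2 ▸ hne)
  have h1 : s 1 = 1 := by
    obtain ⟨w, hw, hne⟩ := hrel 1 0
    have h1 := hs i j k hij hik hjk _ _ hw (by simp [hij, hik, hjk])
    have h2 := (hw.apply_eq_and_ne hf hn3 (i := i) (j := j) (k := k) (by simp [hij, hik, hjk])
      (by simp [hjk, hjk.symm])).2
    simp [hij, hik, hjk, hjk.symm] at h1
    rw [← h2] at h1
    exact mul_right_cancel₀ hne (by rw [one_mul]; exact h1.symm)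
  have hmul : ∀ a b, s (a * b) = s a * s b := by
    intro a b
    by_cases hb : b = 0
    · simp [hb, h0]
    -- With values `0, 1, b, ab` at `i, j, k, l`, the ratio at `l` relative to `j` is the product of
    -- those of `l` to `k` and `k` to `j`.
    obtain ⟨w, hw, hne⟩ := hrel b (a * b)
    have e1 := hs i j k hij hik hjk _ _ hw (by simp [hij, hik, hil, hjk, hjl])
    have e2 := hs i j l hij hil hjl _ _ hw (by simp [hij, hik, hil, hjk, hjl])
    have e3 := hs i k l hik hil hkl _ _ hw (by simp [hij, hik, hil, hjk.symm, hkl, Ne.symm hb])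
    simp [hij, hik, hil, hjk, hjl, hkl, hjk.symm] at e1
    simp [hij, hik, hil, hjk, hjl, hkl.symm, hjl.symm] at e2
    simp [hij, hik, hil, hjk.symm, hkl, hkl.symm, hjl.symm, hb] at e3
    rw [e2, e1, ← mul_assoc] at e3
    exact mul_right_cancel₀ hne e3
  have hsub : ∀ t, s (1 - t) = 1 - s t := by
    intro t
    -- Exchanging the base points `i` and `j` turns the ratio `t` into `1 - t`.
    obtain ⟨w, hw, hne⟩ := hrel t 0
    have e1 := hs i j k hij hik hjk _ _ hw (by simp [hij, hik, hjk])
    have e2 := hs j i k hij.symm hjk hik _ _ hw (by simp [hij, hik, hjk])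
    simp [hij, hik, hjk, hjk.symm] at e1
    simp [hij, hik, hjk, hjk.symm, div_neg] at e2
    refine mul_right_cancel₀ hne ?_
    linear_combination e2 - e1
  obtain ⟨σ, hσ⟩ := exists_ringEquiv_of_map_one_sub h0 h1 hmul hsub
  refine ⟨σ, fun v hv => ?_⟩
  obtain ⟨w, hw⟩ := hf.exists_pencilRel (by omega) hv
  obtain ⟨b, hab⟩ := exists_ne_of_notMem_span_one hv i
  have hvb : v b - v i ≠ 0 := sub_ne_zero.2 hab
  have hib : i ≠ b := fun he => hab (by rw [he])
  have hwb : w b - w i ≠ 0 := sub_ne_zero.2 (hw.apply_ne hf hn3 hab)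
  have hσb : σ (v b) - σ (v i) ≠ 0 := by
    rw [← map_sub]
    exact (map_ne_zero σ).2 hvb
  have hall : ∀ c, w c - w i = σ ((v c - v i) / (v b - v i)) * (w b - w i) := by
    intro c
    by_cases hci : i = c
    · simp [← hci]
    by_cases hcb : b = c
    · rw [← hcb, div_self hvb, map_one, one_mul]
    · rw [hσ]
      exact hs i b c hib hci hcb _ _ hw hab.symm
  have hw' : w = (w i - (w b - w i) / (σ (v b) - σ (v i)) * σ (v i)) • (1 : Fin n → F) +
      ((w b - w i) / (σ (v b) - σ (v i))) • fun k => σ (v k) := by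
    ext c
    have := hall c
    rw [map_div₀, map_sub, map_sub] at this
    simp only [Pi.add_apply, Pi.smul_apply, Pi.one_apply, smul_eq_mul, mul_one]
    rw [sub_eq_iff_eq_add.1 this]
    field_simp
    ring
  rw [hw.2, hw', span_pair_add_smul 1 _ (div_ne_zero hwb hσb)]

end Coordinatization

/-! ### Rigidity: from one fixed pencil to all codes -/

section Rigidity

variable {F : Type*} [Field F] {n : ℕ}

theorem MonomialData.mem_inv_act {m : MonomialData F n} {C : Submodule F (Fin n → F)}
    {y : Fin n → F} : y ∈ m.inv.act C ↔ m.app y ∈ C := by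
  rw [← app_mem_act (m := m), act_inv_act]

/-- The diagonal map with diagonal `x`. -/
def diagonalData (x : Fin n → F) (hx : NowhereZero x) : MonomialData F n :=
  ⟨RingEquiv.refl F, Equiv.refl _, fun j => Units.mk0 (x j) (hx j)⟩

theorem diagonalData_app (x : Fin n → F) (hx : NowhereZero x) (v : Fin n → F) :
    (diagonalData x hx).app v = x * v := by
  ext j
  simp [diagonalData, MonomialData.app]

theorem diagonalData_app_one (x : Fin n → F) (hx : NowhereZero x) :
    (diagonalData x hx).app 1 = x := by
  rw [diagonalData_app, mul_one]

theorem diagonalData_app_unitVec (x : Fin n → F) (hx : NowhereZero x) (i : Fin n) :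
    (diagonalData x hx).app (unitVec F i) = x i • unitVec F i := by
  rw [diagonalData_app]
  ext j
  by_cases h : j = i
  · subst h; simp
  · simp [h]

/-- All codes containing `x` are fixed by `f`. -/
def FixesPencil (f : CodeAut F n 2) (x : Fin n → F) : Prop :=
  ∀ C, IsCode 2 C → x ∈ C → f C = C

/-- The pencils of the standard basis vectors are preserved. -/
def PreservesUnitVec (f : CodeAut F n 2) : Prop :=
  ∀ C, IsCode 2 C → ∀ i, unitVec F i ∈ C → unitVec F i ∈ f C

theorem FixesPencil.mem_iff {f : CodeAut F n 2} {x : Fin n → F} (h : FixesPencil f x)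
    {C : Submodule F (Fin n → F)} (hC : IsCode 2 C) : x ∈ C ↔ x ∈ f C := by
  refine ⟨fun hx => (h C hC hx).symm ▸ hx, fun hx => ?_⟩
  have h1 := f.injOn (f.map_code hC) hC (h _ (f.map_code hC) hx)
  rwa [h1] at hx

/-- `z` is the image of the nowhere zero vector `y` under the map of points induced by `f`. -/
def PointRel (f : CodeAut F n 2) (y z : Fin n → F) : Prop :=
  NowhereZero z ∧ ∀ C, IsCode 2 C → (y ∈ C ↔ z ∈ f C)

theorem PointRel.smul {f : CodeAut F n 2} {y z : Fin n → F} (h : PointRel f y z) {a : F}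
    (ha : a ≠ 0) : PointRel f y (a • z) :=
  ⟨fun i => mul_ne_zero ha (h.1 i), fun C hC => by rw [smul_mem_iff _ ha, h.2 C hC]⟩

theorem nowhereZero_one_add {c : F} (hc : c ≠ -1) (i : Fin n) :
    NowhereZero (1 + c • unitVec F i) := by
  intro j
  by_cases h : j = i
  · subst h
    intro h0
    refine hc ?_
    simp only [Pi.add_apply, Pi.one_apply, Pi.smul_apply, Pi.single_eq_same, smul_eq_mul,
      mul_one] at h0
    linear_combination h0
  · simp [h]

theorem pointRel_mem_span_pair (hn : 4 ≤ n) {f : CodeAut F n 2} (he : PreservesUnitVec f) {x x' z z' : Fin n → F}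
    (hx : NowhereZero x) (hxx' : PointRel f x x') (hzz' : PointRel f z z') {j : Fin n}
    (hz : z ∈ span F {x, unitVec F j}) : z' ∈ span F {x', unitVec F j} := by
  have hcode := isCode_span_pair (by omega) hx (unitVec_notMem_span (F := F) (by omega) hx j)
  have h2 := (hzz'.2 _ hcode).1 hz
  rwa [eq_span_pair (f.map_code hcode).1 (hxx'.1.ne_zero (by omega))
    ((hxx'.2 _ hcode).1 (subset_span (by simp))) (he _ hcode j (subset_span (by simp)))
    (unitVec_notMem_span (by omega) hxx'.1 j)] at h2

/-- For independent `c₁, c₂` in `C`, the planes `⟨x, c₁⟩` and `⟨x, c₂⟩` are fixed, so `f C` meets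
both away from `x` and lies in their span. -/
theorem apply_le_sup_of_fixesPencil (hn : 4 ≤ n) {f : CodeAut F n 2} {x : Fin n → F}
    (hx : NowhereZero x) (hf : FixesPencil f x) {C : Submodule F (Fin n → F)} (hC : IsCode 2 C)
    (hxC : x ∉ C) : f C ≤ C ⊔ span F {x} := by
  have hx0 : x ≠ 0 := hx.ne_zero (by omega)
  have hxfC : x ∉ f C := fun h => hxC ((hf.mem_iff hC).2 h)
  obtain ⟨c₁, hc₁, hc₁0⟩ := exists_mem_ne_zero_of_ne_bot (p := C) (fun h => by
    have := hC.1
    rw [h, finrank_bot] at this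
    omega)
  obtain ⟨c₂, hc₂, hc₁₂⟩ := exists_mem_notMem_of_finrank_lt (S := span F {c₁}) (T := C)
    (by rw [finrank_span_singleton hc₁0, hC.1]; omega)
  have hc₂0 : c₂ ≠ 0 := fun h => hc₁₂ (h ▸ zero_mem _)
  have hs : ∀ {c}, c ≠ 0 → c ∈ C → IsCode 2 (span F {x, c}) := fun h0 hc =>
    isCode_span_pair (by omega) hx (notMem_span_of_mem hxC h0 hc)
  have hmeet : ∀ {c}, c ≠ 0 → c ∈ C → ∃ u, u ≠ 0 ∧ u ∈ f C ∧ u ∈ span F {x, c} := by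
    intro c h0 hc
    obtain ⟨u, hu0, hu1, hu2⟩ := exists_common_image f hC (hs h0 hc) h0 hc (subset_span (by simp))
    rw [hf _ (hs h0 hc) (subset_span (by simp))] at hu2
    exact ⟨u, hu0, hu1, hu2⟩
  have hle : ∀ {c}, c ∈ C → span F {x, c} ≤ C ⊔ span F {x} := by
    intro c hc
    rw [span_le]
    rintro y (rfl | rfl)
    · exact mem_sup_span_self _ _
    · exact mem_sup_left hc
  have hne : span F {x, c₁} ≠ span F {x, c₂} := by
    intro h
    have h2 : c₂ ∈ span F {x, c₁} := h ▸ subset_span (by simp)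
    have h3 := eq_span_pair (hs hc₁0 hc₁).1 hc₁0 (subset_span (by simp)) h2 hc₁₂
    rw [← eq_span_pair hC.1 hc₁0 hc₁ hc₂ hc₁₂] at h3
    exact hxC (h3 ▸ subset_span (by simp))
  exact (transversal_le_sup hx0 (f.map_code hC).1 (hs hc₁0 hc₁).1 (hs hc₂0 hc₂).1
    (subset_span (by simp)) (subset_span (by simp)) hxfC hne (hmeet hc₁0 hc₁)
    (hmeet hc₂0 hc₂)).trans (sup_le (hle hc₁) (hle hc₂))

/-- Only a `C` without nowhere zero vectors needs an argument. If some `a ≠ 0, -1` exists, `C + 1`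
and `C + (1 + a e_j)`, with `e_j` outside `C + 1`, meet in `C`. Otherwise the field has two elements
and coordinates are compared directly. -/
theorem apply_eq_self_of_fixesPencil (hn : 4 ≤ n) {f : CodeAut F n 2}
    (hf : ∀ x, NowhereZero x → FixesPencil f x) {C : Submodule F (Fin n → F)} (hC : IsCode 2 C) :
    f C = C := by
  by_cases hnz : ∃ x ∈ C, NowhereZero x
  · obtain ⟨x, hxC, hx⟩ := hnz
    exact hf x hx C hC hxC
  push Not at hnz
  have hfC := f.map_code hC
  have h1C : (1 : Fin n → F) ∉ C := fun h => hnz 1 h nowhereZero_one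
  have hle := apply_le_sup_of_fixesPencil hn nowhereZero_one (hf 1 nowhereZero_one) hC h1C
  have h1f : (1 : Fin n → F) ∉ f C := fun h => h1C (((hf 1 nowhereZero_one).mem_iff hC).2 h)
  have hU : finrank F (C ⊔ span F {(1 : Fin n → F)} : Submodule F (Fin n → F)) = 3 := by
    rw [finrank_sup_span_of_notMem h1C, hC.1]
  by_cases hq : ∃ a : F, a ≠ 0 ∧ a ≠ -1
  · obtain ⟨a, ha0, ha1⟩ := hq
    obtain ⟨j, hj⟩ := exists_single_notMem (T := C ⊔ span F {(1 : Fin n → F)}) (k := 3) (by omega)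
      hU.le
    have hy := nowhereZero_one_add ha1 j
    have hley := apply_le_sup_of_fixesPencil hn hy (hf _ hy) hC fun h => hnz _ h hy
    refine eq_of_code_le hfC hC fun z hz => ?_
    obtain ⟨c, hc, s, e1⟩ := mem_sup_span.1 (hle hz)
    obtain ⟨d, hd, t, e2⟩ := mem_sup_span.1 (hley hz)
    by_cases ht : t = 0
    · rwa [← e2, ht, zero_smul, add_zero]
    · refine absurd ((smul_mem_iff _ (mul_ne_zero ht ha0)).1 ?_) hj
      refine mem_sup_span.2 ⟨c - d, sub_mem hc hd, s - t, ?_⟩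
      rw [smul_add, smul_smul] at e2
      rw [sub_smul]
      linear_combination e1 - e2
  · push Not at hq
    by_contra hne
    have hmeet : 1 ≤ finrank F (C ⊓ f C : Submodule F (Fin n → F)) := by
      have e1 := finrank_sup_add_finrank_inf_eq C (f C)
      have e2 := finrank_mono (sup_le le_sup_left hle)
      rw [hC.1, hfC.1] at e1
      omega
    obtain ⟨p, ⟨hpC, hpf⟩, hp0⟩ := exists_mem_ne_zero_of_ne_bot (p := C ⊓ f C) (fun h => by
      rw [h, finrank_bot] at hmeet
      omega)
    have hdp : finrank F (span F {p}) = 1 := finrank_span_singleton hp0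
    obtain ⟨u, hu, hup⟩ := exists_mem_notMem_of_finrank_lt (S := span F {p}) (T := C)
      (by rw [hdp, hC.1]; omega)
    obtain ⟨v, hv, hvp⟩ := exists_mem_notMem_of_finrank_lt (S := span F {p}) (T := f C)
      (by rw [hdp, hfC.1]; omega)
    obtain ⟨c, hc, s, hcs⟩ := mem_sup_span.1 (hle hv)
    have hs : s ≠ 0 := by
      rintro rfl
      rw [zero_smul, add_zero] at hcs
      refine hne ?_
      rw [eq_span_pair hfC.1 hp0 hpf hv hvp]
      exact (eq_span_pair hC.1 hp0 hpC (hcs ▸ hc) hvp).symm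
    obtain ⟨α, β, rfl⟩ := mem_comb_of_finrank_two hC.1 hp0 hpC hu hup hc
    have hβ : β ≠ 0 := by
      rintro rfl
      have h2 := sub_mem hv (smul_mem _ α hpf)
      rw [← hcs, zero_smul, add_zero, add_sub_cancel_left, smul_mem_iff _ hs] at h2
      exact h1f h2
    -- At a zero of `p`, non-degeneracy makes both `u i` and `v i` non-zero. But `v i = β * u i +
    -- s`, and all non-zero scalars are `-1`, so `v i = 0`.
    obtain ⟨i, hpi⟩ : ∃ i, p i = 0 := by
      have := hnz p hpC
      simpa [NowhereZero] using this
    have hnon : ∀ {E : Submodule F (Fin n → F)}, IsCode 2 E → ∀ {w}, p ∈ E → w ∈ E →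
        w ∉ span F {p} → w i ≠ 0 := by
      intro E hE w hpE hw hwp hwi
      obtain ⟨x, hx, hxi⟩ := hE.2 i
      obtain ⟨a, b, rfl⟩ := mem_comb_of_finrank_two hE.1 hp0 hpE hw hwp hx
      simp [hpi, hwi] at hxi
    have hui := hnon hC hpC hu hup
    have hvi := hnon hfC hpf hv hvp
    refine hvi ?_
    rw [← hcs]
    simp [hpi, hq s hs, hq β hβ, hq _ hui]

variable [Finite F]

/-- Conjugation by a monomial map. -/
def CodeAut.conj (f : CodeAut F n 2) (m : MonomialData F n) : CodeAut F n 2 :=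
  (CodeAut.ofMonomial 2 m.inv).comp (f.comp (CodeAut.ofMonomial 2 m))

theorem CodeAut.conj_apply (f : CodeAut F n 2) (m : MonomialData F n)
    (C : Submodule F (Fin n → F)) : f.conj m C = m.inv.act (f (m.act C)) := rfl

theorem fixesPencil_conj {f : CodeAut F n 2} {m : MonomialData F n} {x : Fin n → F} :
    FixesPencil (f.conj m) x ↔ FixesPencil f (m.app x) := by
  constructor
  · intro h C hC hx
    have h1 := h (m.inv.act C) (m.inv.isCode_act hC) (m.mem_inv_act.2 hx)
    rw [CodeAut.conj_apply, m.act_inv_act] at h1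
    rw [← m.act_inv_act (f C), h1, m.act_inv_act]
  · intro h C hC hx
    rw [CodeAut.conj_apply, h _ (m.isCode_act hC) (m.app_mem_act.2 hx), m.inv_act_act]

theorem PreservesUnitVec.conj_diagonal {f : CodeAut F n 2} (he : PreservesUnitVec f)
    {x : Fin n → F} (hx : NowhereZero x) : PreservesUnitVec (f.conj (diagonalData x hx)) := by
  intro C hC i hi
  set m := diagonalData x hx
  have h1 := m.app_mem_act.2 hi
  rw [diagonalData_app_unitVec, smul_mem_iff _ (hx i)] at h1
  rw [CodeAut.conj_apply, m.mem_inv_act, diagonalData_app_unitVec, smul_mem_iff _ (hx i)]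
  exact he _ (m.isCode_act hC) i h1

theorem exists_pointRel (hn : 4 ≤ n) (f : CodeAut F n 2) {y : Fin n → F} (hy : NowhereZero y) :
    ∃ z, PointRel f y z := by
  obtain ⟨φ, hφ⟩ := exists_point_map hn f
  exact ⟨φ y, hφ y hy⟩

/-- The plane `⟨1, e_i⟩` is fixed, so the image point stays on it and can be rescaled to have
coefficient one at `1`. -/
theorem exists_pointRel_one_add (hn : 4 ≤ n) {f : CodeAut F n 2} (h1 : FixesPencil f 1) {c : F} (hc : c ≠ -1)
    (i : Fin n) : ∃ c' : F, PointRel f (1 + c • unitVec F i) (1 + c' • unitVec F i) := by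
  obtain ⟨z, hz⟩ := exists_pointRel hn f (nowhereZero_one_add hc i)
  have hcode := isCode_span_one (by omega)
    (unitVec_notMem_span (F := F) (by omega) nowhereZero_one i)
  have hmem := (hz.2 _ hcode).1 (mem_span_pair.2 ⟨1, c, by simp⟩)
  rw [h1 _ hcode (subset_span (by simp))] at hmem
  obtain ⟨a, b, rfl⟩ := mem_span_pair.1 hmem
  obtain ⟨j, hj⟩ := exists_ne_one (by omega) i
  have ha : a ≠ 0 := by simpa [hj] using hz.1 j
  refine ⟨a⁻¹ * b, ?_⟩
  have := hz.smul (inv_ne_zero ha)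
  rwa [smul_add, smul_smul, smul_smul, inv_mul_cancel₀ ha, one_smul] at this

/-- The image of `1 + c e_i + a e_j` is proportional to `1 + c' e_i + a' e_j` because the pencils of
`e_i` and `e_j` are preserved. It also lies on the fixed plane `⟨1, c e_i + a e_j⟩`, so `c' : a' = c
: a`. -/
theorem mul_eq_mul_of_pointRel (hn : 4 ≤ n) {f : CodeAut F n 2} (h1 : FixesPencil f 1) (he : PreservesUnitVec f)
    {i j : Fin n} (hij : i ≠ j) {c a c' a' : F} (hc : c ≠ -1) (ha : a ≠ -1) (hc0 : c ≠ 0)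
    (hcc' : PointRel f (1 + c • unitVec F i) (1 + c' • unitVec F i))
    (haa' : PointRel f (1 + a • unitVec F j) (1 + a' • unitVec F j)) : c' * a = a' * c := by
  set z : Fin n → F := 1 + c • unitVec F i + a • unitVec F j
  have hznz : NowhereZero z := by
    intro l
    by_cases hl : l = j
    · subst hl
      simpa [z, hij.symm] using nowhereZero_one_add ha l l
    · simpa [z, hl] using nowhereZero_one_add hc i l
  obtain ⟨z', hz'⟩ := exists_pointRel hn f hznz
  have m1 := pointRel_mem_span_pair hn he (nowhereZero_one_add hc i) hcc' hz' (j := j)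
    (mem_span_pair.2 ⟨1, a, by simp [z]⟩)
  have m2 := pointRel_mem_span_pair hn he (nowhereZero_one_add ha j) haa' hz' (j := i)
    (mem_span_pair.2 ⟨1, c, by simp only [z, one_smul]; abel⟩)
  obtain ⟨h, hhi, hhj⟩ := exists_ne_two (by omega) i j
  have hnot : c • unitVec F i + a • unitVec F j ∉ span F {(1 : Fin n → F)} :=
    notMem_span_one (i := i) (j := h) (by simp [hij, hhi, hhj, hc0])
  have hcode := isCode_span_one (by omega) hnot
  have m3 := (hz'.2 _ hcode).1 (mem_span_pair.2 ⟨1, 1, by simp only [z, one_smul]; abel⟩)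
  rw [h1 _ hcode (subset_span (by simp))] at m3
  obtain ⟨s, t, e1⟩ := mem_span_pair.1 m1
  obtain ⟨s', t', e2⟩ := mem_span_pair.1 m2
  obtain ⟨r, ε, e3⟩ := mem_span_pair.1 m3
  have a1 := congrFun e1 h
  have a2 := congrFun e2 h
  have a3 := congrFun e3 h
  have b1 := congrFun e1 i
  have b3 := congrFun e3 i
  have c2 := congrFun e2 j
  have c3 := congrFun e3 j
  simp [hhi, hhj] at a1
  simp [hhi, hhj] at a2
  simp [hhi, hhj] at a3
  simp [hij] at b1
  simp [hij] at b3
  simp [hij.symm] at c2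
  simp [hij.symm] at c3
  refine mul_left_cancel₀ (hz'.1 h) ?_
  linear_combination a * (b1 - b3 - (c' + 1) * a1 + a3) - c * (c2 - c3 - (a' + 1) * a2 + a3)

theorem pointRel_self (hn : 4 ≤ n) {f : CodeAut F n 2} (h1 : FixesPencil f 1) (he : PreservesUnitVec f)
    (i : Fin n) {c : F} (hc0 : c ≠ 0) (hc : c ≠ -1) :
    PointRel f (1 + c • unitVec F i) (1 + c • unitVec F i) := by
  obtain ⟨c', hc'⟩ := exists_pointRel_one_add hn h1 hc i
  by_cases heq : c' = c
  · rwa [heq] at hc'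
  exfalso
  obtain ⟨j, hj⟩ := exists_ne_one (by omega) i
  have hc'0 : c' ≠ 0 := by
    rintro rfl
    have hcode := isCode_span_one (by omega)
      (unitVec_notMem_span (F := F) (by omega) nowhereZero_one j)
    have h3 := (hc'.2 _ hcode).2 (by
      rw [h1 _ hcode (subset_span (by simp)), zero_smul, add_zero]
      exact subset_span (by simp))
    have h4 := sub_mem h3 (subset_span (by simp) : (1 : Fin n → F) ∈ span F {1, unitVec F j})
    rw [add_sub_cancel_left, smul_mem_iff _ hc0] at h4
    exact hj (unitVec_unique (by omega) hcode (subset_span (by simp)) h4)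
  -- The parameters are scaled by the common factor `c' / c`, so `-(c / c')` would go to `-1`, whose
  -- point has a zero coordinate.
  have hb0 : -(c / c') ≠ 0 := neg_ne_zero.2 (div_ne_zero hc0 hc'0)
  have hb : -(c / c') ≠ -1 := by
    intro h
    rw [neg_inj, div_eq_one_iff_eq hc'0] at h
    exact heq h.symm
  obtain ⟨a', ha'⟩ := exists_pointRel_one_add hn h1 hc j
  obtain ⟨b', hb'⟩ := exists_pointRel_one_add hn h1 hb i
  have e1 := mul_eq_mul_of_pointRel hn h1 he hj.symm hc hc hc0 hc' ha'
  have e2 := mul_eq_mul_of_pointRel hn h1 he hj.symm hb hc hb0 hb' ha'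
  rw [mul_right_cancel₀ hc0 e1.symm, mul_neg, mul_div_cancel₀ _ hc'0] at e2
  have hb'1 : b' = -1 := mul_right_cancel₀ hc0 (by rw [e2]; ring)
  exact hb'.1 i (by simp [hb'1])

/-- Conjugation by the diagonal map of `y = 1 + c e_i` gives a frame-preserving automorphism, hence
a field automorphism `σ` on the pencil of `y`. Planes joining one vector to `1` and to `y` have
meeting images, and the former is fixed; this forces `σ = 1`. -/
theorem FixesPencil.one_add (hn : 4 ≤ n) {f : CodeAut F n 2} (h1 : FixesPencil f 1) (he : PreservesUnitVec f)
    (i : Fin n) {c : F} (hc0 : c ≠ 0) (hc : c ≠ -1) : FixesPencil f (1 + c • unitVec F i) := by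
  have hynz := nowhereZero_one_add hc i
  have hyy := pointRel_self hn h1 he i hc0 hc
  set y : Fin n → F := 1 + c • unitVec F i
  set m := diagonalData y hynz
  have hm1 : m.app 1 = y := diagonalData_app_one y hynz
  have hfr : PreservesFrame (f.conj m) := by
    refine ⟨fun C hC => ?_, he.conj_diagonal hynz⟩
    rw [CodeAut.conj_apply, m.mem_inv_act, hm1, ← hyy.2 _ (m.isCode_act hC), ← hm1, m.app_mem_act]
  obtain ⟨σ, hσ⟩ := hfr.exists_ringEquiv hn
  obtain ⟨h, hhi⟩ := exists_ne_one (by omega) i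
  obtain ⟨j, hji, hjh⟩ := exists_ne_two (by omega) i h
  obtain ⟨l, hli, hlh, hlj⟩ := exists_ne_three hn i h j
  have hσ1 : ∀ d, σ d = d := by
    intro d
    -- With `v i = 0` the diagonal map fixes `v`. Comparing a common vector of the two images at `l`
    -- and `i`, where `y` differs but `v` vanishes, removes `1` and `y`; coordinates `h` and `j`
    -- then give `σ d = d`.
    set v : Fin n → F := unitVec F h + d • unitVec F j
    have hvi : v i = 0 := by simp [v, hhi.symm, hji.symm]
    have hvh : v h = 1 := by simp [v, hjh.symm]
    have hvj : v j = d := by simp [v, hjh]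
    have hvl : v l = 0 := by simp [v, hlh, hlj]
    have hv1 : v ∉ span F {(1 : Fin n → F)} := notMem_span_one (i := i) (j := h) (by simp [hvi, hvh])
    have hvy : v ∉ span F {y} := notMem_span_singleton hvi (hynz i) (fun h0 => by simp [h0] at hvh)
    have hcode1 := isCode_span_one (by omega) hv1
    have hcodey := isCode_span_pair (by omega) hynz hvy
    have hmv : m.app v = v := by
      rw [diagonalData_app]
      ext k
      by_cases hk : k = i
      · rw [hk, Pi.mul_apply, hvi, mul_zero]
      · simp [y, hk]
    have himg : f (span F {y, v}) = span F {y, m.app fun k => σ (v k)} := by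
      have h2 := congrArg m.act (hσ v hv1)
      rwa [CodeAut.conj_apply, m.act_inv_act, m.act_span, m.act_span, Set.image_pair,
        Set.image_pair, hm1, hmv] at h2
    obtain ⟨u, hu0, hu1, hu2⟩ := exists_common_image f hcode1 hcodey (v := v)
      (fun h0 => by simp [h0] at hvh) (subset_span (by simp)) (subset_span (by simp))
    rw [h1 _ hcode1 (subset_span (by simp))] at hu1
    rw [himg] at hu2
    obtain ⟨a, b, rfl⟩ := mem_span_pair.1 hu1
    obtain ⟨α, β, hαβ⟩ := mem_span_pair.1 hu2
    rw [diagonalData_app] at hαβ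
    have e1 := congrFun hαβ l
    have e2 := congrFun hαβ i
    have e3 := congrFun hαβ h
    have e4 := congrFun hαβ j
    simp [y, hvl, hli] at e1
    simp [y, hvi] at e2
    simp [y, hvh, hhi] at e3
    simp [y, hvj, hji] at e4
    have hα : α = 0 := by
      have : α * c = 0 := by linear_combination e2 - e1
      simpa [hc0] using this
    have ha : a = 0 := by rw [← e1, hα]
    rw [hα, ha] at e3 e4
    simp only [zero_add] at e3 e4
    have hb : b ≠ 0 := by
      rintro rfl
      simp [ha] at hu0
    rw [e3] at e4
    exact mul_left_cancel₀ hb e4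
  have hfix : FixesPencil (f.conj m) 1 := by
    intro C hC h1C
    have hd : finrank F (span F {(1 : Fin n → F)}) = 1 :=
      finrank_span_singleton (nowhereZero_one.ne_zero (by omega))
    obtain ⟨v, hv, hv1⟩ := exists_mem_notMem_of_finrank_lt (S := span F {(1 : Fin n → F)})
      (T := C) (by rw [hC.1, hd]; omega)
    rw [eq_span_pair hC.1 (nowhereZero_one.ne_zero (by omega)) h1C hv hv1, hσ v hv1]
    simp only [hσ1]
  rwa [fixesPencil_conj, hm1] at hfix

/-- Each change of one coordinate is brought to the base point `1` by diagonal conjugation; its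
parameter `(c - x i) / x i` avoids `0` and `-1` because `c ≠ x i` and `c ≠ 0`. -/
theorem FixesPencil.of_one (hn : 4 ≤ n) {f : CodeAut F n 2} (h1 : FixesPencil f 1)
    (he : PreservesUnitVec f) {y : Fin n → F} (hy : NowhereZero y) : FixesPencil f y := by
  refine (nowhereZero_induction (P := fun y => NowhereZero y ∧ FixesPencil f y)
    ⟨nowhereZero_one, h1⟩ ?_ hy).2
  rintro x - i c hc ⟨hx, hfx⟩
  have hnz : NowhereZero (Function.update x i c) := by
    intro j
    by_cases h : j = i
    · subst h; simpa using hc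
    · simpa [h] using hx j
  refine ⟨hnz, ?_⟩
  by_cases hcx : c = x i
  · rwa [hcx, Function.update_eq_self]
  set m := diagonalData x hx
  have h2 : FixesPencil (f.conj m) 1 := by
    rw [fixesPencil_conj, diagonalData_app_one]
    exact hfx
  have hd0 : (c - x i) / x i ≠ 0 := div_ne_zero (sub_ne_zero.2 hcx) (hx i)
  have hd1 : (c - x i) / x i ≠ -1 := by
    intro h
    rw [div_eq_iff (hx i)] at h
    exact hc (by linear_combination h)
  have h3 := h2.one_add hn (he.conj_diagonal hx) i hd0 hd1
  rw [fixesPencil_conj, m.app_add, m.app_smul, diagonalData_app_one, diagonalData_app_unitVec] at h3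
  rw [update_eq_add]
  have h4 : m.σ ((c - x i) / x i) • x i • unitVec F i = (c - x i) • unitVec F i := by
    change ((c - x i) / x i) • x i • unitVec F i = _
    rw [smul_smul, div_mul_cancel₀ _ (hx i)]
  rwa [h4] at h3

/-- Every automorphism of the graph of two-dimensional codes is monomial. -/
theorem CodeAut.isMonomialAut_two (hn : 4 ≤ n) (f : CodeAut F n 2) : f.IsMonomialAut := by
  obtain ⟨δ, hδ⟩ := exists_unitVec_perm hn f
  obtain ⟨x, hx, hxC⟩ := exists_pointRel hn f nowhereZero_one
  -- This sends `1` to its image point `x` and each `e_i` to a multiple of `e_{δ i}`, so dividing by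
  -- it restores the frame.
  let m : MonomialData F n := ⟨RingEquiv.refl F, δ, fun j => Units.mk0 (x j) (hx j)⟩
  have hm1 : m.app 1 = x := by
    ext j
    simp [m, MonomialData.app]
  have hme : ∀ i, m.app (unitVec F i) = x (δ i) • unitVec F (δ i) := by
    intro i
    ext j
    by_cases h : j = δ i
    · subst h
      simp [m, MonomialData.app]
    · have h' : δ.symm j ≠ i := fun he => h (by rw [← he]; simp)
      simp [m, MonomialData.app, h, h']
  have hfr : PreservesFrame ((CodeAut.ofMonomial 2 m.inv).comp f) := by
    refine ⟨fun C hC => ?_, fun C hC i hi => ?_⟩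
    · rw [comp_apply, ofMonomial_apply, m.mem_inv_act, hm1, hxC C hC]
    · rw [comp_apply, ofMonomial_apply, m.mem_inv_act, hme, smul_mem_iff _ (hx _)]
      exact hδ C hC i hi
  refine IsMonomialAut.of_inv_comp (m := m) ?_
  generalize (CodeAut.ofMonomial 2 m.inv).comp f = g at hfr
  obtain ⟨σ, hσ⟩ := hfr.exists_ringEquiv hn
  -- The second normalization removes `σ`, after which every plane through `1` is fixed.
  let m' : MonomialData F n := ⟨σ, Equiv.refl _, 1⟩
  have hm' : ∀ v, m'.app v = fun k => σ (v k) := by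
    intro v
    ext j
    simp [m', MonomialData.app]
  have hm'1 : m'.app 1 = 1 := by
    rw [hm']
    ext j
    simp
  have hm'e : ∀ i, m'.app (unitVec F i) = unitVec F i := by
    intro i
    rw [hm']
    ext j
    by_cases h : j = i
    · subst h; simp
    · simp [h]
  refine IsMonomialAut.of_inv_comp (m := m') (IsMonomialAut.of_eq_self fun C hC =>
    apply_eq_self_of_fixesPencil hn (fun y hy => FixesPencil.of_one hn ?_ ?_ hy) hC)
  · intro C hC h1C
    have hd : finrank F (span F {(1 : Fin n → F)}) = 1 :=
      finrank_span_singleton (nowhereZero_one.ne_zero (by omega))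
    obtain ⟨v, hv, hv1⟩ := exists_mem_notMem_of_finrank_lt (S := span F {(1 : Fin n → F)})
      (T := C) (by rw [hC.1, hd]; omega)
    rw [comp_apply, ofMonomial_apply,
      eq_span_pair hC.1 (nowhereZero_one.ne_zero (by omega)) h1C hv hv1, hσ v hv1, ← hm' v]
    conv_lhs => rw [← hm'1]
    rw [← Set.image_pair, ← m'.act_span, m'.inv_act_act]
  · intro C hC i hi
    rw [comp_apply, ofMonomial_apply, m'.mem_inv_act, hm'e]
    exact hfr.unitVec_mem C hC i hi

theorem CodeAut.isMonomialAut {k : ℕ} (hk : 2 ≤ k) :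
    k + 1 < n → ∀ f : CodeAut F n k, f.IsMonomialAut := by
  induction k, hk using Nat.le_induction with
  | base => exact fun hn f => f.isMonomialAut_two (by omega)
  | succ k hk ih =>
    intro hn f
    obtain ⟨g, hg⟩ := f.exists_lower (by omega) hn
    exact IsMonomialAut.of_lower hk hn (ih (by omega) g) hg

end Rigidity

/-! ### Translation to automorphisms of the graph -/

section Graph

variable {F : Type*} [Field F] {n k : ℕ}

theorem mem_nondegenerateCodes_isCode (C : nondegenerateCodes F n k) : IsCode k C.1.1 :=
  ⟨C.1.2, isNondegenerateCode_iff.1 C.2⟩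

/-- A code as a vertex of the graph. -/
def IsCode.toVertex {C : Submodule F (Fin n → F)} (hC : IsCode k C) : nondegenerateCodes F n k :=
  ⟨⟨C, hC.1⟩, isNondegenerateCode_iff.2 hC.2⟩

/-- The graph automorphism given by an automorphism of codes. -/
def CodeAut.toIso (f : CodeAut F n k) : codeGraph F n k ≃g codeGraph F n k where
  toFun C := (f.map_code (mem_nondegenerateCodes_isCode C)).toVertex
  invFun C := (f.inv_code (mem_nondegenerateCodes_isCode C)).toVertex
  left_inv C := Subtype.ext (Subtype.ext (f.left_inv (mem_nondegenerateCodes_isCode C)))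
  right_inv C := Subtype.ext (Subtype.ext (f.right_inv (mem_nondegenerateCodes_isCode C)))
  map_rel_iff' {C D} := by
    have hC := mem_nondegenerateCodes_isCode C
    have hD := mem_nondegenerateCodes_isCode D
    refine ⟨fun h => ?_, fun h => f.map_adj hC hD h⟩
    have h2 := f.inv_adj (f.map_code hC) (f.map_code hD) h
    rw [f.left_inv hC, f.left_inv hD] at h2
    exact h2

open Classical in
/-- The map of subspaces given by a map of vertices. -/
noncomputable def vertexExtend (f : nondegenerateCodes F n k → nondegenerateCodes F n k)
    (C : Submodule F (Fin n → F)) : Submodule F (Fin n → F) :=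
  if h : IsCode k C then (f h.toVertex).1.1 else C

theorem vertexExtend_of_isCode (f : nondegenerateCodes F n k → nondegenerateCodes F n k)
    {C : Submodule F (Fin n → F)} (h : IsCode k C) : vertexExtend f C = (f h.toVertex).1.1 :=
  dif_pos h

theorem isCode_vertexExtend (f : nondegenerateCodes F n k → nondegenerateCodes F n k)
    {C : Submodule F (Fin n → F)} (h : IsCode k C) : IsCode k (vertexExtend f C) := by
  rw [vertexExtend_of_isCode f h]
  exact mem_nondegenerateCodes_isCode _

/-- The automorphism of codes given by a graph automorphism. -/
noncomputable def CodeAut.ofIso (f : codeGraph F n k ≃g codeGraph F n k) : CodeAut F n k where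
  toFun := vertexExtend f
  invFun := vertexExtend f.symm
  map_code h := isCode_vertexExtend f h
  inv_code h := isCode_vertexExtend f.symm h
  left_inv h := by
    have h2 := isCode_vertexExtend f h
    rw [vertexExtend_of_isCode _ h2]
    have h3 : h2.toVertex = f h.toVertex :=
      Subtype.ext (Subtype.ext (vertexExtend_of_isCode _ h))
    rw [h3, RelIso.symm_apply_apply]
    rfl
  right_inv h := by
    have h2 := isCode_vertexExtend f.symm h
    rw [vertexExtend_of_isCode _ h2]
    have h3 : h2.toVertex = f.symm h.toVertex :=
      Subtype.ext (Subtype.ext (vertexExtend_of_isCode _ h))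
    rw [h3, RelIso.apply_symm_apply]
    rfl
  map_adj hC hD h := by
    rw [vertexExtend_of_isCode _ hC, vertexExtend_of_isCode _ hD]
    exact f.map_rel_iff.2 (show (codeGraph F n k).Adj hC.toVertex hD.toVertex from h)
  inv_adj hC hD h := by
    rw [vertexExtend_of_isCode _ hC, vertexExtend_of_isCode _ hD]
    exact f.symm.map_rel_iff.2 (show (codeGraph F n k).Adj hC.toVertex hD.toVertex from h)

end Graph

theorem theorem2 {F : Type*} [Field F] [Finite F] {n k : ℕ} (hk : 1 < k) (hkn : k + 1 < n) :
    (∀ f : codeGraph F n k ≃g codeGraph F n k,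
      ∃ (σ : F ≃+* F) (l : (Fin n → F) ≃ₛₗ[(σ : F →+* F)] (Fin n → F)),
        IsMonomial l ∧ IsInducedBy f l) ∧
    (∀ C D : nondegenerateCodes F n k,
      SemilinearlyEquivalent C.1.1 D.1.1 ↔
        ∃ f : codeGraph F n k ≃g codeGraph F n k, f C = D) := by
  have hmain : ∀ f : codeGraph F n k ≃g codeGraph F n k,
      ∃ (σ : F ≃+* F) (l : (Fin n → F) ≃ₛₗ[(σ : F →+* F)] (Fin n → F)),
        IsMonomial l ∧ IsInducedBy f l := by
    intro f
    obtain ⟨m, hm⟩ := CodeAut.isMonomialAut hk hkn (CodeAut.ofIso f)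
    refine ⟨m.σ, m.equiv, m.isMonomial_equiv, fun C => ?_⟩
    have hC := mem_nondegenerateCodes_isCode C
    exact (vertexExtend_of_isCode f hC).symm.trans (hm _ hC)
  refine ⟨hmain, fun C D => ⟨?_, ?_⟩⟩
  · rintro ⟨σ, l, hl, hlC⟩
    obtain ⟨m, hm⟩ := MonomialData.exists_of_isMonomial hl
    refine ⟨(CodeAut.ofMonomial k m).toIso, Subtype.ext (Subtype.ext ?_)⟩
    change m.act C.1.1 = D.1.1
    rw [← hlC]
    ext y
    rw [mem_map]
    constructor
    · rintro ⟨x, hx, rfl⟩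
      exact ⟨x, hx, hm x⟩
    · rintro ⟨x, hx, rfl⟩
      exact ⟨x, hx, (hm x).symm⟩
  · rintro ⟨f, rfl⟩
    obtain ⟨σ, l, hl, hf⟩ := hmain f
    exact ⟨σ, l, hl, (hf C).symm⟩
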